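/- **Setting.** There are $M$ cellular users (CUs) $m$ and $N\ge 1$ D2D pairs $n$. Let $p_c,p_d,n_0>0$. In each period the nonnegative channel gains $h_{mb}$ (CU $m$ to base station), $h^m_{nb}$ (transmitter of pair $n$ to base station on channel $m$), $h^m_{nn}$ (inside pair $n$ on channel $m$) are drawn from a fixed joint law, for which the logarithmic rates below are integrable and, for each $n$, the law of $h^m_{nn}$ does not depend on $m$. Put $R^C_m=\mathbb E\ln(1+p_ch_{mb}/n_0)$, $r^C_{mn}=\frac12[\ln(1+p_ch_{mb}/n_0)+\ln(1+p_dh^m_{nb}/n_0)]$, $R^C_{mn}=\mathbb E\,r^C_{mn}>0$, $R^D_{mn}=\mathbb E\ln(1+p_dh^m_{nn}/n_0)$. Let $0\le\alpha_L\le\alpha_U\le1$, $x_m(R)=\frac{R-R^C_m}{2R}$ (with value $0$ at $R=0$) and $\alpha_m(R)=\max(\alpha_L,\min(x_m(R),\alpha_U))$. The Nash bargaining allocation is $\alpha^*_{mn}=\alpha_m(R^C_{mn})$; whenever $U^C_{mn}(\alpha)=(1-\alpha)R^C_{mn}-R^C_m$ and $U^D_{mn}(\alpha)=\alpha R^D_{mn}$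 can both be made positive on $[\alpha_L,\alpha_U]$, it is the unique maximizer of $U^C_{mn}U^D_{mn}$ subject to both being positive. Write $U^C_{mn},U^D_{mn}$ for the values at $\alpha^*_{mn}$. Let $\theta,\theta'>0$, where $\theta<U^C_{mn}$ whenever $U^C_{mn}>0$, and $\alpha_e=\alpha_U+\theta'$. **Matchings.** An action profile $\mathbf b$ assigns to each CU a D2D pair or $b_0$ (no proposal). Given proposals (a profile together with an offered number for each CU), pair $n$ selects among the CUs proposing to it the one with the largest offer; equal offers are ranked by a fixed strict priority order of $n$. $\mu_{\mathbf b}$ is the matching that results from the offers $\alpha^*_{mb_m}$. A matching is stable if $U^C_{mn}>0$ for every matched $(m,n)$ and there is no $(m,n)$, not matched with each other, such that $m$ and $n$ both strictly prefer each other (by $U^C_{m\cdot}$, resp. $U^D_{\cdot n}$) to what they have, being unmatched having value $0$. **No ties.** Assume: (i) if $n\ne n'$ and $U^C_{mn},U^C_{mn'}>0$, then $U^C_{mn}\neq U^C_{mn'}$; (ii) if $m\ne m'$, $U^C_{mn},U^C_{m'n}>0$ and $\alpha^*_{mn}=\alpha^*_{m'n}$, then $x_m(R^C_{mn})$ and $x_{m'}(R^C_{m'n})$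 are both $>\alpha_U$ or both $<\alpha_L$. **Algorithm EBRI-Q.** Parameters: memory length $L\ge1$, $\varepsilon_0\in(0,1]$, $\zeta,\xi\in(0,1)$, $\varepsilon(t)=\varepsilon_0t^{-1/(ML)}$. The proposals of period 1, the estimates $\hat R_{mn}(1)$, CU $m$'s beliefs $\hat\alpha^{1}_{m'n}$ about the offers of CUs $m'\neq m$, and the utility estimates used in period 2 for actions other than $b_0$ are arbitrary; $\alpha^t_{mn}=\alpha_m(\hat R_{mn}(t))$. In each period $t\ge2$, given the past, the CUs act independently of each other: - With probability $\varepsilon(t)$, CU $m$ selects a uniformly random D2D pair $b^t_m$ and offers $\alpha^{t-1}_{mb^t_m}$ with probability $\zeta$, and $\alpha_e$ with probability $1-\zeta$. - With probability $1-\varepsilon(t)$, it offers $\alpha^{t-1}_{mb^t_m}$ for a selection $b^t_m$ found as follows: with probability $\xi$, $b^t_m=b^{t-1}_m$; with probability $1-\xi$, $b^t_m$ is drawn from a fixed fully supported distribution on the set of actions that have strictly larger average estimated utility $\hat\pi_m$ than $b^{t-1}_m$ against the selections of the others in the last $\min(L,t-1)$ periods (the distribution depending on $m$ and this set only), and $b^t_m=b^{t-1}_m$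 if this set is empty. The D2D pairs then select. The gains of period $t$ are independent of the past and of the decisions of period $t$. If $m$ is selected by $n$, then $\hat R_{mn}(t)=\hat R_{mn}(t-1)+\frac{1}{1+k}(r^C_{mn}(t)-\hat R_{mn}(t-1))$, where $k$ is the number of periods $\tau\le t$ in which $n$ selected $m$; otherwise $\hat R_{mn}(t)=\hat R_{mn}(t-1)$. The belief $\hat\alpha^t_{m'n}$ is the offer of $m'$ in period $t$ if $b^t_{m'}=n$ and that offer is not $\alpha_e$; otherwise $\hat\alpha^t_{m'n}=\hat\alpha^{t-1}_{m'n}$. Finally $\hat\pi_m(\mathbf b)=0$ if $b_m=b_0$; if $b_m=n$, then $\hat\pi_m(\mathbf b)=(1-\alpha^t_{mn})\hat R_{mn}(t)-R^C_m-\theta$ when $n$ would select $m$ under the offers $\alpha^t_{mn}$ of $m$ and $\hat\alpha^t_{m'b_{m'}}$ of $m'\neq m$, and $\hat\pi_m(\mathbf b)=-\theta$ otherwise. **Theorem.** Almost surely $\alpha^t_{mn}\to\alpha^*_{mn}$ for all $m,n$, and $\lim_{t\to\infty}\Pr\{\mu_{\mathbf b^t}\text{ is stable}\}=1$, where $\mathbf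 b^t=(b^t_1,\dots,b^t_M)$. -/

import Mathlib

open MeasureTheory ProbabilityTheory Filter Topology

noncomputable section

namespace EBRIQ

/-- One realisation of all channel gains: `g.1 m` is the gain from CU `m` to the base station,
`g.2.1 m n` the gain from the transmitter of D2D pair `n` to the base station on channel `m`, and
`g.2.2 m n` the gain inside D2D pair `n` on channel `m`. -/
abbrev Gains (M N : ℕ) : Type :=
  (Fin M → ℝ) × (Fin M → Fin N → ℝ) × (Fin M → Fin N → ℝ)

/-- A decision profile: each CU proposes to a D2D pair, or to nobody (`none`, the action `b₀`). -/
abbrev Profile (M N : ℕ) : Type := Fin M → Option (Fin N)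

/-- The data of the network. -/
structure Network (M N : ℕ) where
  /-- transmission power of the CUs -/
  pc : ℝ
  /-- transmission power of the D2D transmitters -/
  pd : ℝ
  /-- noise power -/
  n0 : ℝ
  /-- lower end of the interval of time allocations -/
  αL : ℝ
  /-- upper end of the interval of time allocations -/
  αU : ℝ
  /-- negotiation cost -/
  θ : ℝ
  /-- excess of the exploratory offer over `αU` -/
  θ' : ℝ
  /-- joint law of the channel gains in a period -/
  law : Measure (Gains M N)
  /-- predefined tie-breaking rule of D2D pair `n`: equal offers are ranked by `prio n` -/
  prio : Fin N → (Fin M ↪ ℕ)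

namespace Network

variable {M N : ℕ} (G : Network M N)

/-- Rate of CU `m` on the direct link under the gains `g`. -/
def directRate (g : Gains M N) (m : Fin M) : ℝ := Real.log (1 + G.pc * g.1 m / G.n0)

/-- The sample `r^C_{mn}`: rate of CU `m` in the first two phases when relayed by pair `n`. -/
def relayRate (g : Gains M N) (m : Fin M) (n : Fin N) : ℝ :=
  (1 / 2) * (Real.log (1 + G.pc * g.1 m / G.n0) + Real.log (1 + G.pd * g.2.1 m n / G.n0))

/-- Rate inside D2D pair `n` on channel `m`. -/
def d2dRate (g : Gains M N) (m : Fin M) (n : Fin N) : ℝ :=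
  Real.log (1 + G.pd * g.2.2 m n / G.n0)

/-- `R^C_m`, the expected rate of CU `m` on the direct link. -/
def RC₀ (m : Fin M) : ℝ := ∫ g, G.directRate g m ∂G.law

/-- `R^C_{mn}`, the expected relay rate. -/
def RC (m : Fin M) (n : Fin N) : ℝ := ∫ g, G.relayRate g m n ∂G.law

/-- `R^D_{mn}`, the expected rate inside D2D pair `n` on channel `m`. -/
def RD (m : Fin M) (n : Fin N) : ℝ := ∫ g, G.d2dRate g m n ∂G.law

/-- Utility of CU `m` when it cooperates with pair `n` under time allocation `α`. -/
def UC (m : Fin M) (n : Fin N) (α : ℝ) : ℝ := (1 - α) * G.RC m n - G.RC₀ m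

/-- Utility of D2D pair `n` when it cooperates with CU `m` under time allocation `α`. -/
def UD (m : Fin M) (n : Fin N) (α : ℝ) : ℝ := α * G.RD m n

/-- The allocation `(R - R^C_m) / (2R)` before projection onto `[αL, αU]`. -/
def rawAlloc (m : Fin M) (R : ℝ) : ℝ := (R - G.RC₀ m) / (2 * R)

/-- The time allocation `α*_{mn}(R)` as a function of the (true or estimated) relay rate `R`. -/
def alloc (m : Fin M) (R : ℝ) : ℝ := max G.αL (min (G.rawAlloc m R) G.αU)

/-- The Nash bargaining time allocation `α*_{mn}`. -/
def alphaStar (m : Fin M) (n : Fin N) : ℝ := G.alloc m (G.RC m n)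

/-- The exploratory offer `α_e`. -/
def αe : ℝ := G.αU + G.θ'

/-- Utility of CU `m` with pair `n` at the bargaining outcome. -/
def UCstar (m : Fin M) (n : Fin N) : ℝ := G.UC m n (G.alphaStar m n)

/-- Utility of pair `n` with CU `m` at the bargaining outcome. -/
def UDstar (m : Fin M) (n : Fin N) : ℝ := G.UD m n (G.alphaStar m n)

/-- The standing assumptions of the model. -/
structure Standing : Prop where
  pc_pos : 0 < G.pc
  pd_pos : 0 < G.pd
  n0_pos : 0 < G.n0
  αL_nonneg : 0 ≤ G.αL
  αL_le_αU : G.αL ≤ G.αU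
  αU_le_one : G.αU ≤ 1
  law_prob : IsProbabilityMeasure G.law
  gains_nonneg : ∀ᵐ g ∂G.law,
    (∀ m, 0 ≤ g.1 m) ∧ (∀ m n, 0 ≤ g.2.1 m n) ∧ (∀ m n, 0 ≤ g.2.2 m n)
  /-- for each D2D link the gains on the different channels have the same law -/
  d2d_ident : ∀ n m m', G.law.map (fun g => g.2.2 m n) = G.law.map (fun g => g.2.2 m' n)
  direct_integrable : ∀ m, Integrable (fun g => G.directRate g m) G.law
  relay_integrable : ∀ m n, Integrable (fun g => G.relayRate g m n) G.law
  d2d_integrable : ∀ m n, Integrable (fun g => G.d2dRate g m n) G.law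
  RC_pos : ∀ m n, 0 < G.RC m n
  θ_pos : 0 < G.θ
  θ_small : ∀ m n, 0 < G.UCstar m n → G.θ < G.UCstar m n
  θ'_pos : 0 < G.θ'

/-- No ties in the preferences between mutually acceptable partners: a CU is never indifferent
between two acceptable D2D pairs, and two CUs that both accept a D2D pair are tied for it only
if both allocations are cut off at the same end of `[αL, αU]`. -/
structure NoTies : Prop where
  cu : ∀ m n n', n ≠ n' → 0 < G.UCstar m n → 0 < G.UCstar m n' →
    G.UCstar m n ≠ G.UCstar m n'
  d2d : ∀ n m m', m ≠ m' → 0 < G.UCstar m n → 0 < G.UCstar m' n →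
    G.alphaStar m n = G.alphaStar m' n →
      (G.αU < G.rawAlloc m (G.RC m n) ∧ G.αU < G.rawAlloc m' (G.RC m' n)) ∨
      (G.rawAlloc m (G.RC m n) < G.αL ∧ G.rawAlloc m' (G.RC m' n) < G.αL)

/-- The feasible allocations of the bargaining problem of `(m, n)` (disagreement point `0`). -/
def bargainingSet (m : Fin M) (n : Fin N) : Set ℝ :=
  {α | α ∈ Set.Icc G.αL G.αU ∧ 0 < G.UC m n α ∧ 0 < G.UD m n α}

/-- Solutions of the bargaining problem: feasible maximisers of the Nash product. -/
def IsNashBargaining (m : Fin M) (n : Fin N) (α : ℝ) : Prop :=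
  α ∈ G.bargainingSet m n ∧
    ∀ β ∈ G.bargainingSet m n, G.UC m n β * G.UD m n β ≤ G.UC m n α * G.UD m n α

/-- Whenever the bargaining problem is feasible, `α*_{mn}` is its unique solution. -/
theorem isNashBargaining_iff (hG : G.Standing) (m : Fin M) (n : Fin N)
    (hne : (G.bargainingSet m n).Nonempty) (α : ℝ) :
    G.IsNashBargaining m n α ↔ α = G.alphaStar m n := by
  obtain ⟨a, ⟨ha1, ha2⟩, hC, hD⟩ := hne
  have hR := hG.RC_pos m n
  have hL := hG.αL_nonneg
  have ha0 : 0 ≤ a := hL.trans ha1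
  simp only [UC, UD] at hC hD
  have hDpos : 0 < G.RD m n := pos_of_mul_pos_right hD ha0
  have hapos : 0 < a := pos_of_mul_pos_left hD hDpos.le
  obtain ⟨x, hx⟩ : ∃ x, x = G.rawAlloc m (G.RC m n) := ⟨_, rfl⟩
  have hR0 : G.RC₀ m = G.RC m n - 2 * x * G.RC m n := by
    rw [hx, rawAlloc]; field_simp; ring
  have key : ∀ β, G.UC m n β = G.RC m n * (2 * x - β) := by
    intro β; rw [UC, hR0]; ring
  have hax : a < 2 * x := by
    have h : 0 < G.RC m n * (2 * x - a) := by rw [← key]; exact hC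
    linarith [pos_of_mul_pos_right h hR.le]
  have hs : G.alphaStar m n = max G.αL (min x G.αU) := by rw [hx]; rfl
  obtain ⟨s, hsd⟩ : ∃ s, s = G.alphaStar m n := ⟨_, rfl⟩
  rw [← hsd] at hs ⊢
  have hprod : ∀ β, G.UC m n β * G.UD m n β
      = G.RC m n * G.RD m n * (x ^ 2 - (β - x) ^ 2) := by
    intro β; rw [key, UD]; ring
  have hRD : 0 < G.RC m n * G.RD m n := mul_pos hR hDpos
  have hcases : (s = x ∧ G.αL ≤ x ∧ x ≤ G.αU) ∨ (s = G.αL ∧ x < G.αL) ∨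
      (s = G.αU ∧ G.αU < x) := by
    have hLU := hG.αL_le_αU
    rcases lt_or_ge x G.αL with h | h
    · right; left; exact ⟨by rw [hs, min_eq_left (by linarith), max_eq_left h.le], h⟩
    · rcases lt_or_ge G.αU x with h' | h'
      · right; right; exact ⟨by rw [hs, min_eq_right h'.le, max_eq_right hLU], h'⟩
      · left; exact ⟨by rw [hs, min_eq_left h', max_eq_right h], h, h'⟩
  have hLU := hG.αL_le_αU
  have hsmem : s ∈ G.bargainingSet m n := by
    have : G.αL ≤ s ∧ s ≤ G.αU ∧ 0 < s ∧ s < 2 * x := by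
      rcases hcases with ⟨h, h1, h2⟩ | ⟨h, h1⟩ | ⟨h, h1⟩ <;> rw [h] <;>
        refine ⟨?_, ?_, ?_, ?_⟩ <;> linarith
    refine ⟨⟨this.1, this.2.1⟩, ?_, mul_pos this.2.2.1 hDpos⟩
    rw [key]; exact mul_pos hR (by linarith [this.2.2.2])
  have hclose : ∀ β ∈ Set.Icc G.αL G.αU, (s - x) ^ 2 + (β - s) ^ 2 ≤ (β - x) ^ 2 := by
    rintro β ⟨h3, h4⟩
    rcases hcases with ⟨h, h1, h2⟩ | ⟨h, h1⟩ | ⟨h, h1⟩ <;> rw [h] <;> nlinarith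
  constructor
  · rintro ⟨hmem, hmax⟩
    have h1 := hmax s hsmem
    rw [hprod, hprod] at h1
    have h2 := le_of_mul_le_mul_left h1 hRD
    have h3 := hclose α hmem.1
    have h4 : (α - s) ^ 2 = 0 := le_antisymm (by linarith) (sq_nonneg _)
    have := pow_eq_zero_iff (two_ne_zero) |>.mp h4
    linarith
  · rintro rfl
    refine ⟨hsmem, fun β hβ => ?_⟩
    rw [hprod, hprod]
    have := hclose β hβ.1
    exact mul_le_mul_of_nonneg_left (by nlinarith [sq_nonneg (β - α)]) hRD.le

/-! ### Choices of the D2D pairs, matchings and stability -/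

/-- Under the proposals `(b m, a m)`, D2D pair `n` selects CU `m`: it makes the maximal offer
among the CUs proposing to `n`, ties being broken by the predefined rule. -/
def Selects (b : Profile M N) (a : Fin M → ℝ) (n : Fin N) (m : Fin M) : Prop :=
  b m = some n ∧ ∀ m', b m' = some n →
    a m' < a m ∨ (a m' = a m ∧ G.prio n m' ≤ G.prio n m)

theorem Selects.unique {b : Profile M N} {a : Fin M → ℝ} {n : Fin N} {m m' : Fin M}
    (h : G.Selects b a n m) (h' : G.Selects b a n m') : m = m' := by
  rcases h.2 m' h'.1 with h1 | ⟨h1, h2⟩ <;> rcases h'.2 m h.1 with h3 | ⟨h3, h4⟩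
  · exact absurd h1 h3.le.not_gt
  · exact absurd h1 h3.le.not_gt
  · exact absurd h3 h1.le.not_gt
  · exact (G.prio n).injective (le_antisymm h4 h2)

open scoped Classical in
/-- The choice function `Ch_n` of D2D pair `n` under the proposals `(b m, a m)`. -/
def choice (b : Profile M N) (a : Fin M → ℝ) (n : Fin N) : Option (Fin M) :=
  if h : ∃ m, G.Selects b a n m then some h.choose else none

theorem choice_eq_some_iff (b : Profile M N) (a : Fin M → ℝ) (n : Fin N) (m : Fin M) :
    G.choice b a n = some m ↔ G.Selects b a n m := by
  unfold choice
  split_ifs with h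
  · rw [Option.some_inj]
    exact ⟨fun e => e ▸ h.choose_spec, fun hm => h.choose_spec.unique G hm⟩
  · exact ⟨fun e => absurd e (by simp), fun hm => absurd ⟨m, hm⟩ h⟩

/-- The true offers attached to a profile: `α*_{m b_m}`. -/
def trueOffer (b : Profile M N) (m : Fin M) : ℝ :=
  match b m with
  | some n => G.alphaStar m n
  | none => 0

open scoped Classical in
/-- The matching `μ_b` associated with the profile `b`: `m` and `n` are matched iff
`Ch_n(b) = m` under the true offers. Matchings are partial bijections. -/
def matching (b : Profile M N) : Fin M ≃. Fin N where
  toFun m := if ∃ n, b m = some n ∧ G.choice b (G.trueOffer b) n = some m then b m else none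
  invFun n := G.choice b (G.trueOffer b) n
  inv := by
    intro m n
    constructor
    · intro h
      have hb := ((G.choice_eq_some_iff _ _ _ _).1 h).1
      rw [if_pos ⟨n, hb, h⟩, hb]
    · intro h
      split_ifs at h with h'
      obtain ⟨k, hk, hc⟩ := h'
      rw [hk, Option.some_inj] at h
      exact h ▸ hc

/-- Utility of CU `m` from a partner, being unmatched having utility `0`. -/
def cuValue (m : Fin M) : Option (Fin N) → ℝ
  | some n => G.UCstar m n
  | none => 0

/-- Utility of D2D pair `n` from a partner, being unmatched having utility `0`. -/
def d2dValue (n : Fin N) : Option (Fin M) → ℝ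
  | some m => G.UDstar m n
  | none => 0

/-- `(m, n)` blocks `μ`: not matched together, and both strictly prefer each other. -/
def Blocks (μ : Fin M ≃. Fin N) (m : Fin M) (n : Fin N) : Prop :=
  μ m ≠ some n ∧ G.d2dValue n (μ.symm n) < G.d2dValue n (some m) ∧
    G.cuValue m (μ m) < G.cuValue m (some n)

/-- Stable matchings: matched CUs find their partners acceptable, and no pair blocks. -/
def IsStable (μ : Fin M ≃. Fin N) : Prop :=
  (∀ m n, μ m = some n → 0 < G.cuValue m (some n)) ∧ ¬ ∃ m n, G.Blocks μ m n

end Network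

/-! ### The algorithm -/

/-- Parameters and initial values of the algorithm. -/
structure Params (M N : ℕ) where
  /-- scale of the exploration rate -/
  ε₀ : ℝ
  /-- probability that an exploring CU offers its estimated allocation rather than `α_e` -/
  ζ : ℝ
  /-- inertia -/
  ξ : ℝ
  /-- memory length -/
  L : ℕ
  /-- `reply m S` is the law used by CU `m` to pick an element of a set `S` of better replies -/
  reply : Fin M → Finset (Option (Fin N)) → PMF (Option (Fin N))
  /-- the selections of period 1 -/
  b1 : Profile M N
  /-- the offers of period 1 -/
  a1 : Fin M → ℝ
  /-- initial estimates of the relay rates -/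
  Rhat1 : Fin M → Fin N → ℝ
  /-- `αhat1 m m' n`: initial belief of CU `m` about the offer of CU `m'` to pair `n` -/
  αhat1 : Fin M → Fin M → Fin N → ℝ
  /-- initial estimates of the utilities -/
  πhat1 : Fin M → Profile M N → ℝ

namespace Params

variable {M N : ℕ}

/-- The admissible parameters. -/
structure Valid (P : Params M N) : Prop where
  ε₀_pos : 0 < P.ε₀
  ε₀_le : P.ε₀ ≤ 1
  ζ_pos : 0 < P.ζ
  ζ_lt : P.ζ < 1
  ξ_pos : 0 < P.ξ
  ξ_lt : P.ξ < 1
  L_pos : 1 ≤ P.L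
  reply_support : ∀ m S, S.Nonempty → (P.reply m S).support = (S : Set (Option (Fin N)))

/-- The exploration rate `ε(t) = ε₀ t^{-1/(ML)}`. -/
def ε (P : Params M N) (t : ℕ) : ℝ := P.ε₀ * (t : ℝ) ^ (-1 / ((M : ℝ) * (P.L : ℝ)))

end Params

/-- What the CUs have learnt at the end of a period. -/
structure State (M N : ℕ) where
  /-- estimates of the relay rates -/
  Rhat : Fin M → Fin N → ℝ
  /-- numbers of past cooperations -/
  count : Fin M → Fin N → ℕ
  /-- `αhat m m' n`: belief of CU `m` about the offer of CU `m'` to pair `n` -/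
  αhat : Fin M → Fin M → Fin N → ℝ

/-- The random decision of a CU in a period: its selection, and whether it offers `α_e` (`true`)
or the allocation computed from its current estimate (`false`). -/
abbrev Decision (N : ℕ) : Type := Option (Fin N) × Bool

section Algorithm

variable {M N : ℕ} (G : Network M N) (P : Params M N)

/-- The offers made in a period, from the estimates of the previous period. -/
def offer (s : State M N) (d : Fin M → Decision N) (m : Fin M) : ℝ :=
  if (d m).2 then G.αe else
    match (d m).1 with
    | some n => G.alloc m (s.Rhat m n)
    | none => 0

/-- The state at the end of period 1. -/
def initState : State M N where
  Rhat := P.Rhat1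
  count m n := if G.choice P.b1 P.a1 n = some m then 1 else 0
  αhat := P.αhat1

/-- One period: from the state `s`, the decisions `d` and the channel gains `g` of the period. -/
def step (s : State M N) (d : Fin M → Decision N) (g : Gains M N) : State M N :=
  let b : Profile M N := fun m => (d m).1
  let a : Fin M → ℝ := offer G s d
  let I : Fin M → Fin N → ℕ := fun m n => if G.choice b a n = some m then 1 else 0
  { Rhat := fun m n => s.Rhat m n +
      1 / (1 + ((s.count m n + I m n : ℕ) : ℝ)) * (I m n : ℝ) *
        (G.relayRate g m n - s.Rhat m n)
    count := fun m n => s.count m n + I m n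
    αhat := fun m m' n =>
      open scoped Classical in
      if b m' = some n ∧ a m' ≠ G.αe then a m' else s.αhat m m' n }

/-- The state at the end of period `t`, along decisions `d` and gains `g`; the loop of the
algorithm starts at period 2 (the value at `t = 0` is a dummy). -/
def stateAt (d : ℕ → Fin M → Decision N) (g : ℕ → Gains M N) : ℕ → State M N
  | 0 => initState G P
  | 1 => initState G P
  | t + 2 => step G (stateAt d g (t + 1)) (d (t + 2)) (g (t + 2))

/-- The selections `b^t`. -/
def selection (d : ℕ → Fin M → Decision N) (t : ℕ) : Profile M N :=
  if t ≤ 1 then P.b1 else fun m => (d t m).1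

/-- The estimated allocations `α^t_{mn}`. -/
def alphaAt (d : ℕ → Fin M → Decision N) (g : ℕ → Gains M N) (t : ℕ) (m : Fin M) (n : Fin N) :
    ℝ :=
  G.alloc m ((stateAt G P d g t).Rhat m n)

/-- The estimated utility `π̂_m(b)` at the end of period `t`; refusing to cooperate is worth `0`. -/
def πhat (d : ℕ → Fin M → Decision N) (g : ℕ → Gains M N) (t : ℕ) (m : Fin M)
    (b : Profile M N) : ℝ :=
  match b m with
  | none => 0
  | some n =>
    if t ≤ 1 then P.πhat1 m b
    else
      let a : Fin M → ℝ := fun m' =>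
        if m' = m then alphaAt G P d g t m n
        else
          match b m' with
          | some k => (stateAt G P d g t).αhat m m' k
          | none => 0
      if G.choice b a n = some m then
        (1 - alphaAt G P d g t m n) * (stateAt G P d g t).Rhat m n - G.RC₀ m - G.θ
      else -G.θ

/-- Estimated total utility of action `x` of CU `m` against its memory before period `t`, i.e.
against the selections of the others in the last `L` periods (or all periods, if fewer than `L`
have passed), as evaluated at the end of period `t - 1`. -/
def memoryValue (d : ℕ → Fin M → Decision N) (g : ℕ → Gains M N) (t : ℕ) (m : Fin M)
    (x : Option (Fin N)) : ℝ :=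
  ∑ τ ∈ Finset.Ico (max 1 (t - P.L)) t,
    πhat G P d g (t - 1) m (Function.update (selection P d τ) m x)

open scoped Classical in
/-- The actions that are better replies of CU `m` to its memory than `b^{t-1}_m`. -/
def betterReplies (d : ℕ → Fin M → Decision N) (g : ℕ → Gains M N) (t : ℕ) (m : Fin M) :
    Finset (Option (Fin N)) :=
  {x | memoryValue G P d g t m (selection P d (t - 1) m) < memoryValue G P d g t m x}

open scoped Classical in
/-- Probability that the non-inert better-reply move of CU `m` in period `t` is `x`; without
better replies the CU keeps its previous selection. -/
def replyProb (d : ℕ → Fin M → Decision N) (g : ℕ → Gains M N) (t : ℕ) (m : Fin M)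
    (x : Option (Fin N)) : ℝ :=
  if (betterReplies G P d g t m).Nonempty then
    (P.reply m (betterReplies G P d g t m) x).toReal
  else if x = selection P d (t - 1) m then 1 else 0

/-- Probability that an exploring CU takes the decision `y`. -/
def exploreProb (y : Decision N) : ℝ :=
  match y with
  | (some _, true) => (1 / (N : ℝ)) * (1 - P.ζ)
  | (some _, false) => (1 / (N : ℝ)) * P.ζ
  | (none, _) => 0

/-- Probability that a non-exploring CU `m` takes the decision `y` in period `t`. -/
def exploitProb (d : ℕ → Fin M → Decision N) (g : ℕ → Gains M N) (t : ℕ) (m : Fin M)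
    (y : Decision N) : ℝ :=
  match y with
  | (_, true) => 0
  | (x, false) => P.ξ * (if x = selection P d (t - 1) m then 1 else 0) +
      (1 - P.ξ) * replyProb G P d g t m x

/-- Probability, given the past, that CU `m` takes the decision `y` in period `t`. Only the
values of `d` and `g` before period `t` matter. -/
def decisionProb (d : ℕ → Fin M → Decision N) (g : ℕ → Gains M N) (t : ℕ) (m : Fin M)
    (y : Decision N) : ℝ :=
  P.ε t * exploreProb P y + (1 - P.ε t) * exploitProb G P d g t m y

/-- `D t` and `g t` are the decisions and the channel gains in period `t` of a run of the
algorithm: given the past, the CUs take their decisions independently of each other with the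
prescribed probabilities, and the gains of the period have law `G.law` and are independent of the
past and of the decisions. -/
structure IsRun {Ω : Type*} {mΩ : MeasurableSpace Ω} (μ : Measure Ω) (ℱ : Filtration ℕ mΩ)
    (D : ℕ → Ω → Fin M → Decision N) (g : ℕ → Ω → Gains M N) : Prop where
  decision_adapted : ∀ t, 2 ≤ t → Measurable[ℱ t, ⊤] (D t)
  gains_adapted : ∀ t, 2 ≤ t → Measurable[ℱ t] (g t)
  gains_law : ∀ t, 2 ≤ t → μ.map (g t) = G.law
  gains_indep : ∀ t, 2 ≤ t →
    Indep (MeasurableSpace.comap (g t) inferInstance)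
      (ℱ (t - 1) ⊔ MeasurableSpace.comap (D t) ⊤) μ
  decision_law : ∀ t, 2 ≤ t → ∀ y : Fin M → Decision N,
    μ[Set.indicator {ω | D t ω = y} (fun _ => (1 : ℝ)) | ℱ (t - 1)] =ᵐ[μ]
      fun ω => ∏ m, decisionProb G P (fun τ => D τ ω) (fun τ => g τ ω) t m (y m)

end Algorithm

end EBRIQ

end

/-! Estimation. A given joint decision in which every CU proposes has conditional probability at
least a constant times `ε(t)^M`, hence at least a constant over `t`. The harmonic series diverges,
so by Lévy's conditional Borel–Cantelli lemma each such decision recurs infinitely often almost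
surely (`ae_frequently_eq`). When all CUs propose to `n` and only `m` offers `α_e`, pair `n` selects
`m`; thus every `R̂_{mn}` is updated infinitely often, at times decided before the gains are drawn,
and a strong law along predictable times gives `R̂_{mn} → R^C_{mn}`. The allocation is continuous at
positive rates, which is the first claim. When all CUs propose to `n` with their estimated
allocations, all beliefs about offers to `n` are refreshed. Because of `θ` and the absence of ties,
the estimates eventually rank all relevant options exactly as the true utilities do (`Accurate`).

Game. With correct rankings the CUs play a proposal game that is weakly acyclic: from every profile
some sequence of single better replies ends in an equilibrium (`Market.exists_equilibrium`), and
equilibria induce stable matchings (`isStable_of_isEquilibrium`).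

Dynamics. Inertia keeps a profile for `L` periods with probability bounded below, after which the
memory is constant and a better reply to it is a better reply to the current profile. So a rank
built from the distance to equilibrium and the steadiness of the profile drops with probability
bounded below. Rank `0` is left with probability at most `1 - (1 - ε)^M`, which vanishes. The drift
criterion `tendsto_measureReal_rank_ne_zero` then applies on the event that the estimates have been
accurate since period `T`; this event has probability close to `1` for large `T`. -/

noncomputable section

namespace EBRIQ

/-! ### Better replies in a two-sided matching market -/

namespace Market

variable {I J K : Type*} [LinearOrder K] (u : I → J → ℝ) (κ : J → I → K)

/-- Against the proposals of the others in `b`, agent `i` would be selected by `j`. -/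
def Wins (b : I → Option J) (i : I) (j : J) : Prop :=
  ∀ k, k ≠ i → b k = some j → κ j k ≤ κ j i

open scoped Classical in
/-- Ordinal value of the reply `x` of `i` to `b`: being rejected is worse than not proposing. -/
def value (b : I → Option J) (i : I) : Option J → ℝ
  | none => 0
  | some j => if Wins κ b i j then u i j else -1

/-- The reply `x` is not a proposal to an unacceptable partner. -/
def Acceptable (i : I) (x : Option J) : Prop := ∀ j, x = some j → 0 < u i j

/-- One agent revises: it either withdraws from an unacceptable partner or, if there are no such
proposals, moves to a strictly better acceptable reply. -/
def Step [DecidableEq I] (b b' : I → Option J) : Prop :=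
  ∃ i x, b' = Function.update b i x ∧
    ((¬ Acceptable u i (b i) ∧ x = none) ∨
      ((∀ k, Acceptable u k (b k)) ∧ Acceptable u i x ∧
        value u κ b i (b i) < value u κ b i x))

/-- Profiles of acceptable proposals without acceptable better replies. -/
def IsEquilibrium (b : I → Option J) : Prop :=
  (∀ k, Acceptable u k (b k)) ∧
    ∀ i x, Acceptable u i x → value u κ b i x ≤ value u κ b i (b i)

/-- Profiles of acceptable proposals in which no proposer has an acceptable better reply. -/
def IsSettled (b : I → Option J) : Prop :=
  (∀ k, Acceptable u k (b k)) ∧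
    ∀ i j, b i = some j → ∀ x, Acceptable u i x → value u κ b i x ≤ value u κ b i (some j)

variable {u κ}

theorem acceptable_none (i : I) : Acceptable u i (none : Option J) := by
  intro j h; cases h

theorem value_some_of_wins {b : I → Option J} {i : I} {j : J} (h : Wins κ b i j) :
    value u κ b i (some j) = u i j := by
  simp [value, h]

theorem value_some_of_not_wins {b : I → Option J} {i : I} {j : J} (h : ¬ Wins κ b i j) :
    value u κ b i (some j) = -1 := by
  simp [value, h]

theorem neg_one_le_value {b : I → Option J} {i : I} {x : Option J} (hx : Acceptable u i x) :
    -1 ≤ value u κ b i x := by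
  cases x with
  | none => simp [value]
  | some j =>
    have := hx j rfl
    by_cases h : Wins κ b i j
    · rw [value_some_of_wins h]; linarith
    · rw [value_some_of_not_wins h]

/-- A lost win replaces `u i j` by `-1`, which is the least value an acceptable reply can have. -/
theorem value_mono {b c : I → Option J} {i : I} {x : Option J} (hx : Acceptable u i x)
    (h : ∀ j, Wins κ b i j → Wins κ c i j) : value u κ b i x ≤ value u κ c i x := by
  cases x with
  | none => simp [value]
  | some j =>
    by_cases hb : Wins κ b i j
    · rw [value_some_of_wins hb, value_some_of_wins (h j hb)]
    · rw [value_some_of_not_wins hb]; exact neg_one_le_value hx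

theorem wins_of_value_nonneg {b : I → Option J} {i : I} {j : J}
    (h : 0 ≤ value u κ b i (some j)) : Wins κ b i j := by
  by_contra hn
  rw [value_some_of_not_wins hn] at h
  norm_num at h

theorem IsSettled.wins {b : I → Option J} (h : IsSettled u κ b) {i : I} {j : J}
    (hi : b i = some j) : Wins κ b i j :=
  wins_of_value_nonneg (h.2 i j hi none (acceptable_none i))

variable [Fintype J]

open scoped Classical in
/-- Position of the reply `x` in the ranking of `i`, not proposing being counted best. -/
def position (u : I → J → ℝ) (i : I) : Option J → ℕ
  | none => 0
  | some j => 1 + (Finset.univ.filter fun j' => u i j < u i j').card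

theorem position_lt {i : I} {j j' : J} (h : u i j < u i j') :
    position u i (some j') < position u i (some j) := by
  classical
  simp only [position]
  refine Nat.add_lt_add_left (Finset.card_lt_card ?_) 1
  refine Finset.ssubset_iff_subset_ne.2 ⟨fun k hk => ?_, fun he => ?_⟩
  · simp only [Finset.mem_filter, Finset.mem_univ, true_and] at hk ⊢
    exact h.trans hk
  · have : j' ∈ Finset.univ.filter fun k => u i j < u i k := by simpa using h
    rw [← he] at this
    simp at this

variable [Fintype I] [DecidableEq I]

theorem sum_position_update_lt {b : I → Option J} {i : I} {x : Option J}
    (h : position u i x < position u i (b i)) :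
    ∑ k, position u k (Function.update b i x k) < ∑ k, position u k (b k) := by
  refine Finset.sum_lt_sum (fun k _ => ?_) ⟨i, Finset.mem_univ i, by simpa using h⟩
  rcases eq_or_ne k i with rfl | hk
  · simpa using h.le
  · rw [Function.update_of_ne hk]

/-- An unacceptable or rejected proposal is withdrawn, and an accepted one is exchanged for a better
partner. Either way the reviser moves up its own ranking, and positions do not depend on what the
others do, so their sum is a potential. -/
theorem exists_step_of_not_settled {b : I → Option J} (hb : ¬ IsSettled u κ b) :
    ∃ b', Step u κ b b' ∧ ∑ k, position u k (b' k) < ∑ k, position u k (b k) := by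
  by_cases hacc : ∀ k, Acceptable u k (b k)
  · have : ∃ i j x, b i = some j ∧ Acceptable u i x ∧
        value u κ b i (some j) < value u κ b i x := by
      by_contra! hn
      exact hb ⟨hacc, fun i j hi x hx => hn i j x hi hx⟩
    obtain ⟨i, j, x, hi, hx, hlt⟩ := this
    have hj : 0 < u i j := hacc i j hi
    by_cases hw : Wins κ b i j
    · rw [value_some_of_wins hw] at hlt
      cases x with
      | none => simp only [value] at hlt; linarith
      | some j' =>
        have hw' : Wins κ b i j' := wins_of_value_nonneg (hj.trans hlt).le
        refine ⟨_, ⟨i, some j', rfl, Or.inr ⟨hacc, hx, ?_⟩⟩, sum_position_update_lt ?_⟩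
        · rw [hi, value_some_of_wins hw]; exact hlt
        · rw [value_some_of_wins hw'] at hlt
          rw [hi]; exact position_lt hlt
    · refine ⟨_, ⟨i, none, rfl, Or.inr ⟨hacc, acceptable_none i, ?_⟩⟩,
        sum_position_update_lt ?_⟩
      · rw [hi, value_some_of_not_wins hw]; simp [value]
      · rw [hi]; simp [position]
  · push Not at hacc
    obtain ⟨i, hi⟩ := hacc
    refine ⟨_, ⟨i, none, rfl, Or.inl ⟨hi, rfl⟩⟩, sum_position_update_lt ?_⟩
    cases h : b i with
    | none => rw [h] at hi; exact absurd (acceptable_none i) hi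
    | some j => simp [position]

theorem exists_settled (b : I → Option J) :
    ∃ b', Relation.ReflTransGen (Step u κ) b b' ∧ IsSettled u κ b' := by
  induction hn : ∑ k, position u k (b k) using Nat.strong_induction_on generalizing b with
  | _ n ih =>
    by_cases hb : IsSettled u κ b
    · exact ⟨b, .refl, hb⟩
    · obtain ⟨c, hc, hlt⟩ := exists_step_of_not_settled hb
      obtain ⟨b', h1, h2⟩ := ih _ (hn ▸ hlt) c rfl
      exact ⟨b', .head hc h1, h2⟩

open scoped Classical in
/-- The pairs `(j, i)` such that `i` would strictly improve the position of `j`. -/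
def improvers (κ : J → I → K) (b : I → Option J) : Finset (J × I) :=
  {p | ∀ k, b k = some p.1 → κ p.1 k < κ p.1 p.2}

/-- This is a round of deferred acceptance. An idle agent proposes to the best `j` that would take
it, and the displaced proposer, if any, withdraws. Side `J` only gains, so winning becomes harder
for everybody: proposers stay content and the set of improving pairs shrinks. The displaced agent is
idle, so settledness asks nothing of it. -/
theorem exists_settled_of_not_equilibrium (hκ : ∀ j, Function.Injective (κ j))
    {b : I → Option J} (hb : IsSettled u κ b) (hne : ¬ IsEquilibrium u κ b) :
    ∃ b', Relation.ReflTransGen (Step u κ) b b' ∧ IsSettled u κ b' ∧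
      (improvers κ b').card < (improvers κ b).card := by
  classical
  have : ∃ i x, Acceptable u i x ∧ value u κ b i (b i) < value u κ b i x := by
    by_contra! hn
    exact hne ⟨hb.1, hn⟩
  obtain ⟨i, x, hx, hlt⟩ := this
  have hi : b i = none := by
    cases h : b i with
    | none => rfl
    | some j => rw [h] at hlt; exact absurd (hb.2 i j h x hx) hlt.not_ge
  rw [hi] at hlt
  have hne : (Finset.univ.filter fun j => Wins κ b i j ∧ 0 < u i j).Nonempty := by
    cases x with
    | none => exact absurd hlt (lt_irrefl _)
    | some j =>
      exact ⟨j, by simpa using ⟨wins_of_value_nonneg (le_of_lt hlt), hx j rfl⟩⟩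
  -- The best winnable partner is chosen, and not just any improvement, so that `i` has no better
  -- reply afterwards.
  obtain ⟨j, hj, hmax⟩ := Finset.exists_max_image _ (fun j => u i j) hne
  simp only [Finset.mem_filter, Finset.mem_univ, true_and, and_imp] at hj hmax
  obtain ⟨hwin, hpos⟩ := hj
  have haccj : Acceptable u i (some j) := by
    intro j' h; cases h; exact hpos
  have huniq : ∀ k k', b k = some j → b k' = some j → k = k' := by
    intro k k' hk hk'
    by_contra hkk
    exact hkk (hκ j (le_antisymm (hb.wins hk' k hkk hk) (hb.wins hk k' (Ne.symm hkk) hk')))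
  have hstep : Step u κ b (Function.update b i (some j)) := by
    refine ⟨i, some j, rfl, Or.inr ⟨hb.1, haccj, ?_⟩⟩
    rw [hi, value_some_of_wins hwin]
    exact hpos
  have hpath : ∃ c : I → Option J, Relation.ReflTransGen (Step u κ) b c ∧ c i = some j ∧
      (∀ k, k ≠ i → b k = some j → c k = none) ∧
      (∀ k, k ≠ i → b k ≠ some j → c k = b k) := by
    by_cases hex : ∃ k, b k = some j
    -- The former proposer `k` now loses to `i` strictly, by injectivity of `κ j`; being rejected is
    -- worth `-1`, so withdrawing is a better reply.
    · obtain ⟨k, hk⟩ := hex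
      have hki : k ≠ i := by rintro rfl; rw [hi] at hk; cases hk
      refine ⟨Function.update (Function.update b i (some j)) k none,
        .tail (.single hstep) ⟨k, none, rfl, Or.inr ⟨?_, acceptable_none k, ?_⟩⟩, ?_, ?_, ?_⟩
      · intro l
        rcases eq_or_ne l i with rfl | hl
        · simpa using haccj
        · rw [Function.update_of_ne hl]; exact hb.1 l
      · rw [Function.update_of_ne hki, hk, value_some_of_not_wins]
        · simp [value]
        · intro h
          have h1 := h i hki.symm (by simp)
          exact hki (hκ j (le_antisymm (hwin k hki hk) h1))
      · rw [Function.update_of_ne hki.symm]; simp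
      · intro l _ hlj
        rw [huniq l k hlj hk]; simp
      · intro l hl hlj
        rw [Function.update_of_ne (by rintro rfl; exact hlj hk), Function.update_of_ne hl]
    · push Not at hex
      refine ⟨_, .single hstep, by simp, fun k _ hkj => absurd hkj (hex k), fun k hk _ => ?_⟩
      rw [Function.update_of_ne hk]
  obtain ⟨c, hc, hci, hcj, hcr⟩ := hpath
  have honly : ∀ k, c k = some j → k = i := by
    intro k hk
    by_contra hki
    by_cases hkj : b k = some j
    · rw [hcj k hki hkj] at hk; cases hk
    · rw [hcr k hki hkj] at hk; exact hkj hk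
  have hsame : ∀ k l, l ≠ j → (c k = some l ↔ b k = some l) := by
    intro k l hl
    rcases eq_or_ne k i with rfl | hki
    · rw [hci, hi]; simp [hl.symm]
    · by_cases hkj : b k = some j
      · rw [hcj k hki hkj, hkj]; simp [hl.symm]
      · rw [hcr k hki hkj]
  have hwsame : ∀ k l, l ≠ j → (Wins κ c k l ↔ Wins κ b k l) := by
    intro k l hl
    simp only [Wins, hsame _ l hl]
  -- Only the proposals to `j` have changed, and there `i` is at least as strong as anyone who
  -- proposed before.
  have hwle : ∀ k l, Wins κ c k l → Wins κ b k l := by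
    intro k l h
    rcases eq_or_ne l j with rfl | hl
    · rcases eq_or_ne k i with rfl | hki
      · exact hwin
      · intro k' hk' hbk'
        have hk'i : k' ≠ i := by rintro rfl; rw [hi] at hbk'; cases hbk'
        exact (hwin k' hk'i hbk').trans (h i hki.symm hci)
    · exact (hwsame k l hl).1 h
  have hcacc : ∀ k, Acceptable u k (c k) := by
    intro k
    rcases eq_or_ne k i with rfl | hki
    · rw [hci]; exact haccj
    · by_cases hkj : b k = some j
      · rw [hcj k hki hkj]; exact acceptable_none k
      · rw [hcr k hki hkj]; exact hb.1 k
  clear hlt hx x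
  refine ⟨c, hc, ⟨hcacc, fun k l hk x hx => ?_⟩, Finset.card_lt_card ?_⟩
  · rcases eq_or_ne l j with rfl | hl
    · obtain rfl := honly k hk
      have hwc : Wins κ c k l := fun k' hk' h => absurd (honly k' h) hk'
      rw [value_some_of_wins hwc]
      refine (value_mono hx (hwle k)).trans ?_
      cases x with
      | none => exact hpos.le
      | some l' =>
        by_cases hw : Wins κ b k l'
        · rw [value_some_of_wins hw]; exact hmax l' hw (hx l' rfl)
        · rw [value_some_of_not_wins hw]; linarith
    · have hbk := (hsame k l hl).1 hk
      refine (value_mono hx (hwle k)).trans ((hb.2 k l hbk x hx).trans (le_of_eq ?_))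
      simp only [value, hwsame k l hl]
  · refine Finset.ssubset_iff_subset_ne.2 ⟨fun p hp => ?_, fun he => ?_⟩
    · obtain ⟨l, k⟩ := p
      simp only [improvers, Finset.mem_filter, Finset.mem_univ, true_and] at hp ⊢
      rcases eq_or_ne l j with rfl | hl
      · intro k' hk'
        have hk'i : k' ≠ i := by rintro rfl; rw [hi] at hk'; cases hk'
        exact (hwin k' hk'i hk').trans_lt (hp i hci)
      · intro k' hk'
        exact hp k' ((hsame k' l hl).2 hk')
    -- The inclusion is strict because `(j, i)` itself is lost: `i` cannot beat its own proposal.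
    · have h1 : (j, i) ∈ improvers κ b := by
        simp only [improvers, Finset.mem_filter, Finset.mem_univ, true_and]
        intro k hk
        have hki : k ≠ i := by rintro rfl; rw [hi] at hk; cases hk
        exact lt_of_le_of_ne (hwin k hki hk) fun h => hki (hκ j h)
      rw [← he] at h1
      simp only [improvers, Finset.mem_filter, Finset.mem_univ, true_and] at h1
      exact lt_irrefl _ (h1 i hci)

theorem exists_equilibrium (hκ : ∀ j, Function.Injective (κ j)) (b : I → Option J) :
    ∃ b', Relation.ReflTransGen (Step u κ) b b' ∧ IsEquilibrium u κ b' := by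
  obtain ⟨c, hc, hset⟩ := exists_settled (u := u) (κ := κ) b
  suffices H : ∃ b', Relation.ReflTransGen (Step u κ) c b' ∧ IsEquilibrium u κ b' by
    obtain ⟨b', h1, h2⟩ := H
    exact ⟨b', hc.trans h1, h2⟩
  clear hc
  induction hn : (improvers κ c).card using Nat.strong_induction_on generalizing c with
  | _ n ih =>
    by_cases he : IsEquilibrium u κ c
    · exact ⟨c, .refl, he⟩
    · obtain ⟨d, hd, hds, hlt⟩ := exists_settled_of_not_equilibrium hκ hset he
      obtain ⟨b', h1, h2⟩ := ih _ (hn ▸ hlt) d hds rfl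
      exact ⟨b', hd.trans h1, h2⟩

/-- Profiles from which an equilibrium can be reached in `n` revisions. -/
def Reaches (u : I → J → ℝ) (κ : J → I → K) : ℕ → (I → Option J) → Prop
  | 0, b => IsEquilibrium u κ b
  | n + 1, b => ∃ b', Step u κ b b' ∧ Reaches u κ n b'

/-- A rank that vanishes at equilibria only and that some revision lowers elsewhere. -/
theorem exists_rank (hκ : ∀ j, Function.Injective (κ j)) :
    ∃ d : (I → Option J) → ℕ, ∀ b,
      (d b = 0 → IsEquilibrium u κ b) ∧ (d b ≠ 0 → ∃ b', Step u κ b b' ∧ d b' < d b) := by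
  classical
  have hex : ∀ b, ∃ n, Reaches u κ n b := by
    intro b
    obtain ⟨b', h1, h2⟩ := exists_equilibrium (u := u) hκ b
    induction h1 using Relation.ReflTransGen.head_induction_on with
    | refl => exact ⟨0, h2⟩
    | head h _ ih =>
      obtain ⟨n, hn⟩ := ih
      exact ⟨n + 1, _, h, hn⟩
  refine ⟨fun b => Nat.find (hex b), fun b => ⟨fun h => ?_, fun h => ?_⟩⟩
  · have := Nat.find_spec (hex b)
    dsimp only at h
    rw [h] at this
    exact this
  · obtain ⟨n, hn⟩ := Nat.exists_eq_succ_of_ne_zero h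
    dsimp only at hn
    have := Nat.find_spec (hex b)
    rw [hn] at this
    obtain ⟨b', h1, h2⟩ := this
    refine ⟨b', h1, ?_⟩
    have : Nat.find (hex b') ≤ n := Nat.find_min' (hex b') h2
    change Nat.find (hex b') < Nat.find (hex b)
    omega

end Market

/-! ### Equilibria of the proposal game and stable matchings -/

namespace Network

variable {M N : ℕ} (G : Network M N)

/-- The ranking of the CUs by D2D pair `n`: by their bargaining allocations, then by priority. -/
def merit (n : Fin N) (m : Fin M) : ℝ ×ₗ ℕ := toLex (G.alphaStar m n, G.prio n m)

theorem merit_injective (n : Fin N) : Function.Injective (G.merit n) := by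
  intro m m' h
  exact (G.prio n).injective (congrArg (fun p => (ofLex p).2) h)

theorem merit_le_iff (n : Fin N) (m m' : Fin M) :
    G.merit n m' ≤ G.merit n m ↔ G.alphaStar m' n < G.alphaStar m n ∨
      (G.alphaStar m' n = G.alphaStar m n ∧ G.prio n m' ≤ G.prio n m) := by
  simp [merit, Prod.Lex.toLex_le_toLex]

variable {G}

theorem Standing.RD_nonneg (hG : G.Standing) (m : Fin M) (n : Fin N) : 0 ≤ G.RD m n := by
  refine integral_nonneg_of_ae ?_
  filter_upwards [hG.gains_nonneg] with g hg
  have h := div_nonneg (mul_nonneg hG.pd_pos.le (hg.2.2 m n)) hG.n0_pos.le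
  exact Real.log_nonneg (by linarith)

/-- The rate is a fixed measurable function of a gain whose law does not depend on the channel.
Hence a D2D pair compares CUs by their allocations alone, which is what its choice rule looks at. -/
theorem Standing.RD_eq (hG : G.Standing) (m m' : Fin M) (n : Fin N) :
    G.RD m n = G.RD m' n := by
  have hf : Measurable fun x : ℝ => Real.log (1 + G.pd * x / G.n0) := by fun_prop
  have key : ∀ k, G.RD k n =
      ∫ x, Real.log (1 + G.pd * x / G.n0) ∂(G.law.map fun g => g.2.2 k n) := by
    intro k
    rw [integral_map (by fun_prop) hf.aestronglyMeasurable]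
    rfl
  rw [key, key, hG.d2d_ident n m m']

theorem selects_trueOffer_iff (b : Profile M N) (n : Fin N) (m : Fin M) :
    G.Selects b (G.trueOffer b) n m ↔ b m = some n ∧ Market.Wins G.merit b m n := by
  have h : ∀ k, b k = some n → G.trueOffer b k = G.alphaStar k n := by
    intro k hk; simp [trueOffer, hk]
  refine and_congr_right fun hm => ⟨fun hs k _ hk => ?_, fun hs k hk => ?_⟩
  · have := hs k hk
    rwa [h k hk, h m hm, ← merit_le_iff] at this
  · rw [h k hk, h m hm, ← merit_le_iff]
    rcases eq_or_ne k m with rfl | hkm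
    · exact le_rfl
    · exact hs k hkm hk

/-- At an equilibrium nobody is rejected, since withdrawing would be better, so the matching is the
profile itself. In a blocking pair `(m, n)` the strict preference of `n` means a larger allocation
from `m`, so `m` would win `n`, and proposing to `n` would be a better reply. -/
theorem isStable_of_isEquilibrium (hG : G.Standing) {b : Profile M N}
    (hb : Market.IsEquilibrium G.UCstar G.merit b) : G.IsStable (G.matching b) := by
  have hval : ∀ i, 0 ≤ Market.value G.UCstar G.merit b i (b i) :=
    fun i => hb.2 i none (Market.acceptable_none i)
  have hwins : ∀ i j, b i = some j → Market.Wins G.merit b i j := by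
    intro i j hij
    have := hval i
    rw [hij] at this
    exact Market.wins_of_value_nonneg this
  have hchoice : ∀ i j, G.choice b (G.trueOffer b) j = some i ↔ b i = some j := by
    intro i j
    rw [choice_eq_some_iff, selects_trueOffer_iff]
    exact ⟨fun h => h.1, fun h => ⟨h, hwins i j h⟩⟩
  have hmatch : ∀ i, G.matching b i = b i := by
    intro i
    change (if _ then _ else _) = _
    split_ifs with h
    · rfl
    · cases hbi : b i with
      | none => rfl
      | some j => exact absurd ⟨j, hbi, (hchoice i j).2 hbi⟩ h
  refine ⟨fun m n h => ?_, ?_⟩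
  · rw [hmatch] at h
    exact hb.1 m n h
  · rintro ⟨m, n, hne, hd, hc⟩
    rw [hmatch] at hne hc
    change G.d2dValue n (G.choice b (G.trueOffer b) n) < _ at hd
    have hcu : G.cuValue m (b m) = Market.value G.UCstar G.merit b m (b m) := by
      cases h : b m with
      | none => rfl
      | some j => rw [Market.value_some_of_wins (hwins m j h)]; rfl
    rw [hcu] at hc
    have hpos : 0 < G.UCstar m n := (hval m).trans_lt hc
    have hw : Market.Wins G.merit b m n := by
      intro k hkm hk
      rw [(hchoice k n).2 hk] at hd
      simp only [d2dValue, UDstar, UD, hG.RD_eq k m n] at hd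
      rw [merit_le_iff]
      exact Or.inl (lt_of_mul_lt_mul_right hd (hG.RD_nonneg m n))
    have := hb.2 m (some n) (by intro j h; cases h; exact hpos)
    rw [Market.value_some_of_wins hw] at this
    exact absurd this hc.not_ge

end Network

/-! ### The strong law of large numbers under optional skipping -/

section OptionalSkipping

open scoped Classical

variable {Ω : Type*} {mΩ : MeasurableSpace Ω} {μ : Measure Ω}

/-- The event that `t` is the `j`-th time in `s`. -/
def nthEvent (s : ℕ → Set Ω) (j t : ℕ) : Set Ω :=
  {ω | ω ∈ s t ∧ Nat.count (fun τ => ω ∈ s τ) t = j}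

/-- The sequence `r` sampled at the `j`-th time in `s`. -/
def sampled (s : ℕ → Set Ω) (r : ℕ → Ω → ℝ) (j : ℕ) (ω : Ω) : ℝ :=
  r (Nat.nth (fun τ => ω ∈ s τ) j) ω

theorem nth_eq_of_mem_nthEvent {s : ℕ → Set Ω} {j t : ℕ} {ω : Ω} (h : ω ∈ nthEvent s j t) :
    Nat.nth (fun τ => ω ∈ s τ) j = t := by
  rw [← h.2]; exact Nat.nth_count h.1

theorem mem_nthEvent_nth {s : ℕ → Set Ω} {ω : Ω} (h : {t | ω ∈ s t}.Infinite) (j : ℕ) :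
    ω ∈ nthEvent s j (Nat.nth (fun τ => ω ∈ s τ) j) :=
  ⟨Nat.nth_mem_of_infinite h j, Nat.count_nth_of_infinite h j⟩

/-- The second alternative is the default value: `Nat.nth` is `0` when there is no `j`-th time. -/
theorem nth_eq_iff {s : ℕ → Set Ω} {j t : ℕ} {ω : Ω} :
    Nat.nth (fun τ => ω ∈ s τ) j = t ↔
      ω ∈ nthEvent s j t ∨ (t = 0 ∧ ∀ t', ω ∉ nthEvent s j t') := by
  constructor
  · rintro rfl
    by_cases h : ∃ t', ω ∈ nthEvent s j t'
    · obtain ⟨t', ht'⟩ := h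
      left
      rw [nth_eq_of_mem_nthEvent ht']; exact ht'
    · push Not at h
      refine Or.inr ⟨?_, h⟩
      by_contra h0
      refine h (Nat.nth (fun τ => ω ∈ s τ) j) ⟨?_, ?_⟩
      · exact Nat.nth_mem j fun hf => by
          by_contra hc
          exact h0 (Nat.nth_of_card_le hf (not_lt.1 hc))
      · exact Nat.count_nth fun hf => by
          by_contra hc
          exact h0 (Nat.nth_of_card_le hf (not_lt.1 hc))
  · rintro (h | ⟨rfl, h⟩)
    · exact nth_eq_of_mem_nthEvent h
    · by_contra h0
      have hlt : ∀ hf : {τ | ω ∈ s τ}.Finite, j < hf.toFinset.card := fun hf => by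
        by_contra hc
        exact h0 (Nat.nth_of_card_le hf (not_lt.1 hc))
      exact h _ ⟨Nat.nth_mem j hlt, Nat.count_nth hlt⟩

theorem measurableSet_nthEvent {m : ℕ → MeasurableSpace Ω} (hm : Monotone m) {s : ℕ → Set Ω}
    (hs : ∀ t, MeasurableSet[m t] (s t)) (j t : ℕ) : MeasurableSet[m t] (nthEvent s j t) := by
  have hc : ∀ t' ≤ t, ∀ k, MeasurableSet[m t]
      {ω | Nat.count (fun τ => ω ∈ s τ) t' = k} := by
    intro t'
    induction t' with
    | zero => intro _ k; simp
    | succ t' ih =>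
      intro ht k
      have hst : MeasurableSet[m t] (s t') := hm (by omega) _ (hs t')
      have : {ω | Nat.count (fun τ => ω ∈ s τ) (t' + 1) = k} =
          (s t' ∩ {ω | Nat.count (fun τ => ω ∈ s τ) t' + 1 = k}) ∪
            ((s t')ᶜ ∩ {ω | Nat.count (fun τ => ω ∈ s τ) t' = k}) := by
        ext ω
        by_cases h : ω ∈ s t' <;> simp [Nat.count_succ, h]
      rw [this]
      refine (hst.inter ?_).union (hst.compl.inter (ih (by omega) k))
      cases k with
      | zero => simp
      | succ k => simpa using ih (by omega) k
  exact (hs t).inter (hc t le_rfl j)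

theorem measurable_sampled {s : ℕ → Set Ω} (hs : ∀ t, MeasurableSet (s t)) {r : ℕ → Ω → ℝ}
    (hr : ∀ t, Measurable (r t)) (j : ℕ) : Measurable (sampled s r j) := by
  have hE : ∀ t, MeasurableSet (nthEvent s j t) :=
    measurableSet_nthEvent (m := fun _ => mΩ) monotone_const hs j
  have hT : Measurable fun ω => Nat.nth (fun τ => ω ∈ s τ) j := by
    refine measurable_to_countable' fun t => ?_
    have : (fun ω => Nat.nth (fun τ => ω ∈ s τ) j) ⁻¹' {t} =
        nthEvent s j t ∪ ({_ω | t = 0} ∩ ⋂ t', (nthEvent s j t')ᶜ) := by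
      ext ω
      simp [nth_eq_iff]
    rw [this]
    exact (hE t).union ((MeasurableSet.const _).inter (MeasurableSet.iInter fun t' => (hE t').compl))
  intro B hB
  have : sampled s r j ⁻¹' B =
      ⋃ t, (fun ω => Nat.nth (fun τ => ω ∈ s τ) j) ⁻¹' {t} ∩ r t ⁻¹' B := by
    ext ω; simp [sampled]
  rw [this]
  exact MeasurableSet.iUnion fun t => (hT (measurableSet_singleton t)).inter (hr t hB)

theorem measure_eq_tsum_nthEvent {s : ℕ → Set Ω} (hs : ∀ t, MeasurableSet (s t))
    (hinf : ∀ᵐ ω ∂μ, {t | ω ∈ s t}.Infinite) (j : ℕ) {A : Set Ω} (hA : MeasurableSet A) :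
    μ A = ∑' t, μ (A ∩ nthEvent s j t) := by
  have hE : ∀ t, MeasurableSet (nthEvent s j t) :=
    measurableSet_nthEvent (m := fun _ => mΩ) monotone_const hs j
  rw [← measure_iUnion]
  · refine measure_congr ?_
    filter_upwards [hinf] with ω hω
    refine propext ⟨fun h => ?_, fun h => ?_⟩
    · exact Set.mem_iUnion.2 ⟨_, h, mem_nthEvent_nth hω j⟩
    · obtain ⟨t, ht⟩ := Set.mem_iUnion.1 h
      exact ht.1
  · intro t t' htt
    refine Set.disjoint_left.2 fun ω h h' => htt ?_
    rw [← nth_eq_of_mem_nthEvent h.2, ← nth_eq_of_mem_nthEvent h'.2]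
  · exact fun t => hA.inter (hE t)

variable {m : ℕ → MeasurableSpace Ω} {s : ℕ → Set Ω} {r : ℕ → Ω → ℝ}

/-- Split according to the value `t` of the `j`-th time. On that piece the sample is `r t`, which is
independent of `m t`, while `A` intersected with the piece belongs to `m t`. The choice `A = univ`
gives the law of the sample; an event about an earlier sample gives independence. -/
theorem measure_inter_sampled (hle : ∀ t, m t ≤ mΩ)
    (hs : ∀ t, MeasurableSet[m t] (s t)) (hr : ∀ t, Measurable[m (t + 1)] (r t))
    (hid : ∀ t, IdentDistrib (r t) (r 0) μ μ)
    (hindep : ∀ t, Indep (MeasurableSpace.comap (r t) inferInstance) (m t) μ)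
    (hinf : ∀ᵐ ω ∂μ, {t | ω ∈ s t}.Infinite) (j : ℕ) {A : Set Ω} (hA : MeasurableSet A)
    (hAm : ∀ t, MeasurableSet[m t] (A ∩ nthEvent s j t)) {B : Set ℝ} (hB : MeasurableSet B) :
    μ (A ∩ sampled s r j ⁻¹' B) = μ A * μ (r 0 ⁻¹' B) := by
  have hs' : ∀ t, MeasurableSet (s t) := fun t => hle t _ (hs t)
  have hr' : ∀ t, Measurable (r t) := fun t => (hr t).mono (hle _) le_rfl
  rw [measure_eq_tsum_nthEvent hs' hinf j (hA.inter (measurable_sampled hs' hr' j hB)),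
    measure_eq_tsum_nthEvent hs' hinf j hA, ← ENNReal.tsum_mul_right]
  refine tsum_congr fun t => ?_
  have h1 : A ∩ sampled s r j ⁻¹' B ∩ nthEvent s j t = r t ⁻¹' B ∩ (A ∩ nthEvent s j t) := by
    ext ω
    constructor
    · rintro ⟨⟨h1, h2⟩, h3⟩
      refine ⟨?_, h1, h3⟩
      rw [Set.mem_preimage, sampled, nth_eq_of_mem_nthEvent h3] at h2
      exact h2
    · rintro ⟨h1, h2, h3⟩
      refine ⟨⟨h2, ?_⟩, h3⟩
      rw [Set.mem_preimage, sampled, nth_eq_of_mem_nthEvent h3]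
      exact h1
  rw [h1, (Indep_iff _ _ μ).1 (hindep t) _ _ ⟨B, hB, rfl⟩ (hAm t), mul_comm,
    (hid t).measure_preimage_eq hB]

variable [IsProbabilityMeasure μ]

theorem identDistrib_sampled (hm : Monotone m) (hle : ∀ t, m t ≤ mΩ)
    (hs : ∀ t, MeasurableSet[m t] (s t)) (hr : ∀ t, Measurable[m (t + 1)] (r t))
    (hid : ∀ t, IdentDistrib (r t) (r 0) μ μ)
    (hindep : ∀ t, Indep (MeasurableSpace.comap (r t) inferInstance) (m t) μ)
    (hinf : ∀ᵐ ω ∂μ, {t | ω ∈ s t}.Infinite) (j : ℕ) :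
    IdentDistrib (sampled s r j) (r 0) μ μ := by
  have hs' : ∀ t, MeasurableSet (s t) := fun t => hle t _ (hs t)
  have hr' : ∀ t, Measurable (r t) := fun t => (hr t).mono (hle _) le_rfl
  have hY := measurable_sampled hs' hr' j
  refine ⟨hY.aemeasurable, (hr' 0).aemeasurable, Measure.ext fun B hB => ?_⟩
  rw [Measure.map_apply hY hB, Measure.map_apply (hr' 0) hB]
  have := measure_inter_sampled hle hs hr hid hindep hinf j MeasurableSet.univ
    (fun t => by simpa using measurableSet_nthEvent hm hs j t) hB
  simpa using this

/-- Pairwise independence is all that the strong law requires. -/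
theorem indepFun_sampled (hm : Monotone m) (hle : ∀ t, m t ≤ mΩ)
    (hs : ∀ t, MeasurableSet[m t] (s t)) (hr : ∀ t, Measurable[m (t + 1)] (r t))
    (hid : ∀ t, IdentDistrib (r t) (r 0) μ μ)
    (hindep : ∀ t, Indep (MeasurableSpace.comap (r t) inferInstance) (m t) μ)
    (hinf : ∀ᵐ ω ∂μ, {t | ω ∈ s t}.Infinite) {i j : ℕ} (hij : i < j) :
    IndepFun (sampled s r i) (sampled s r j) μ := by
  have hs' : ∀ t, MeasurableSet (s t) := fun t => hle t _ (hs t)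
  have hr' : ∀ t, Measurable (r t) := fun t => (hr t).mono (hle _) le_rfl
  refine indepFun_iff_measure_inter_preimage_eq_mul.2 fun A B hA hB => ?_
  rw [measure_inter_sampled hle hs hr hid hindep hinf j (measurable_sampled hs' hr' i hA) _ hB,
    (identDistrib_sampled hm hle hs hr hid hindep hinf j).measure_preimage_eq hB]
  intro t
  -- If the `j`-th time is `t`, the `i`-th time is some `u < t`, and `r u` is already known to `m (u
  -- + 1) ≤ m t`.
  have : sampled s r i ⁻¹' A ∩ nthEvent s j t =
      (⋃ u : Fin t, nthEvent s i u ∩ r u ⁻¹' A) ∩ nthEvent s j t := by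
    ext ω
    refine and_congr_left fun hj => ?_
    have hn := nth_eq_of_mem_nthEvent hj
    have hcard : ∀ hf : {τ | ω ∈ s τ}.Finite, i < hf.toFinset.card := by
      intro hf
      by_contra hc
      have h1 : Nat.count (fun τ => ω ∈ s τ) (t + 1) ≤ hf.toFinset.card := by
        rw [Nat.count_eq_card_filter_range]
        refine Finset.card_le_card fun k hk => ?_
        rw [Set.Finite.mem_toFinset]
        exact (Finset.mem_filter.1 hk).2
      rw [Nat.count_succ, if_pos hj.1, hj.2] at h1
      omega
    have hi : ω ∈ nthEvent s i (Nat.nth (fun τ => ω ∈ s τ) i) :=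
      ⟨Nat.nth_mem i hcard, Nat.count_nth hcard⟩
    have hlt : Nat.nth (fun τ => ω ∈ s τ) i < t := by
      by_contra hc
      have := Nat.count_monotone (fun τ => ω ∈ s τ) (not_lt.1 hc)
      rw [hi.2, hj.2] at this
      omega
    simp only [Set.mem_preimage, Set.mem_iUnion, sampled]
    constructor
    · intro h
      exact ⟨⟨_, hlt⟩, hi, h⟩
    · rintro ⟨u, hu, h⟩
      rw [nth_eq_of_mem_nthEvent hu]; exact h
  rw [this]
  refine MeasurableSet.inter (MeasurableSet.iUnion fun u => ?_) (measurableSet_nthEvent hm hs j t)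
  exact MeasurableSet.inter (hm u.2.le _ (measurableSet_nthEvent hm hs i u))
    (hm (Nat.succ_le_of_lt u.2) _ (hr u hA))

theorem sum_sampled (s : ℕ → Set Ω) (r : ℕ → Ω → ℝ) (ω : Ω) (n : ℕ) :
    ∑ τ ∈ Finset.range n, (if ω ∈ s τ then r τ ω else 0) =
      ∑ i ∈ Finset.range (Nat.count (fun τ => ω ∈ s τ) n), sampled s r i ω := by
  induction n with
  | zero => simp
  | succ n ih =>
    rw [Finset.sum_range_succ, ih, Nat.count_succ]
    by_cases h : ω ∈ s n
    · rw [if_pos h, if_pos h, Finset.sum_range_succ, sampled]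
      rw [Nat.nth_count (p := fun τ => ω ∈ s τ) h]
    · simp [h]

theorem tendsto_count_atTop {p : ℕ → Prop} (h : {t | p t}.Infinite) :
    Tendsto (fun n => Nat.count p n) atTop atTop := by
  refine tendsto_atTop_atTop.2 fun k => ⟨Nat.nth p k, fun n hn => ?_⟩
  rw [← Nat.count_nth_of_infinite h k]
  exact Nat.count_monotone p hn

/-- Strong law of large numbers for an i.i.d. sequence sampled at predictable times. -/
theorem strong_law_optional_skipping (hm : Monotone m) (hle : ∀ t, m t ≤ mΩ)
    (hs : ∀ t, MeasurableSet[m t] (s t)) (hr : ∀ t, Measurable[m (t + 1)] (r t))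
    (hid : ∀ t, IdentDistrib (r t) (r 0) μ μ) (hint : Integrable (r 0) μ)
    (hindep : ∀ t, Indep (MeasurableSpace.comap (r t) inferInstance) (m t) μ)
    (hinf : ∀ᵐ ω ∂μ, {t | ω ∈ s t}.Infinite) :
    ∀ᵐ ω ∂μ, Tendsto (fun n => (∑ τ ∈ Finset.range n, if ω ∈ s τ then r τ ω else 0) /
      (Nat.count (fun τ => ω ∈ s τ) n : ℝ)) atTop (𝓝 (∫ ω, r 0 ω ∂μ)) := by
  have hY := identDistrib_sampled hm hle hs hr hid hindep hinf
  have hlaw := strong_law_ae_real (sampled s r) ((hY 0).integrable_iff.2 hint)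
    (fun i j hij => ?_) fun i => (hY i).trans (hY 0).symm
  · filter_upwards [hlaw, hinf] with ω h1 h2
    rw [(hY 0).integral_eq] at h1
    simp only [sum_sampled]
    exact h1.comp (tendsto_count_atTop h2)
  · rcases lt_or_gt_of_ne hij with h | h
    · exact indepFun_sampled hm hle hs hr hid hindep hinf h
    · exact (indepFun_sampled hm hle hs hr hid hindep hinf h).symm

end OptionalSkipping

/-! ### A drift criterion -/

/-- Once `e t < δ * (a / 2)`, the recursion is dominated by the affine contraction with fixed point
`a / 2`, so `v` ends up below `a`. -/
theorem tendsto_zero_of_contraction {v e : ℕ → ℝ} {δ : ℝ} {T : ℕ} (hδ : 0 < δ) (hδ1 : δ ≤ 1)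
    (hv : ∀ t, 0 ≤ v t) (he : Tendsto e atTop (𝓝 0))
    (h : ∀ t ≥ T, v (t + 1) ≤ (1 - δ) * v t + e t) : Tendsto v atTop (𝓝 0) := by
  refine tendsto_order.2 ⟨fun a ha => Eventually.of_forall fun t => ha.trans_le (hv t),
    fun a ha => ?_⟩
  have h1 : ∀ᶠ t in atTop, e t < δ * (a / 2) := he.eventually_lt_const (by positivity)
  obtain ⟨T', hT'⟩ := eventually_atTop.1 (h1.and (eventually_ge_atTop T))
  have hrec : ∀ n, v (T' + n) ≤ a / 2 + (1 - δ) ^ n * v T' := by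
    intro n
    induction n with
    | zero => simp; linarith
    | succ n ih =>
      obtain ⟨h2, h3⟩ := hT' (T' + n) (by omega)
      have h4 := h (T' + n) h3
      have h5 := mul_le_mul_of_nonneg_left ih (by linarith : 0 ≤ 1 - δ)
      rw [← add_assoc, pow_succ]
      nlinarith
  have h6 : Tendsto (fun n => a / 2 + (1 - δ) ^ n * v T') atTop (𝓝 (a / 2 + 0 * v T')) :=
    ((tendsto_pow_atTop_nhds_zero_of_lt_one (by linarith) (by linarith)).mul_const _).const_add _
  have h7 := h6.eventually_lt_const (by linarith : a / 2 + 0 * v T' < a)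
  obtain ⟨n, hn⟩ := eventually_atTop.1 h7
  refine eventually_atTop.2 ⟨T' + n, fun t ht => ?_⟩
  obtain ⟨k, rfl⟩ := Nat.exists_eq_add_of_le (show T' ≤ t by omega)
  exact (hrec k).trans_lt (hn k (by omega))

section Drift

variable {Ω S : Type*} {mΩ : MeasurableSpace Ω} {μ : Measure Ω} [IsProbabilityMeasure μ]

theorem sum_measureReal_inter_eq {X : Ω → S} (hX : ∀ s, MeasurableSet {ω | X ω = s})
    (B : Set Ω) (F : Finset S) :
    ∑ s ∈ F, μ.real (B ∩ {ω | X ω = s}) = μ.real (B ∩ {ω | X ω ∈ F}) := by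
  classical
  induction F using Finset.induction_on with
  | empty => simp
  | insert a F ha ih =>
    rw [Finset.sum_insert ha, ih]
    have hsplit := measureReal_inter_add_sdiff (μ := μ) (s := B ∩ {ω | X ω ∈ insert a F}) (hX a)
    rw [← hsplit]
    congr 2
    · ext ω
      simp only [Set.mem_inter_iff, Set.mem_ofPred_eq, Finset.mem_insert]
      tauto
    · ext ω
      simp only [Set.mem_inter_iff, Set.mem_ofPred_eq, Finset.mem_insert, Set.mem_sdiff]
      constructor
      · rintro ⟨h1, h2⟩
        exact ⟨⟨h1, Or.inr h2⟩, fun h => ha (h ▸ h2)⟩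
      · rintro ⟨⟨h1, h2 | h2⟩, h3⟩
        · exact absurd h2 h3
        · exact ⟨h1, h2⟩

/-- A finite-valued process whose rank decreases with probability at least `q` unless it is `0`,
and stays `0` up to vanishing probabilities, has rank `0` with probability tending to `1`. -/
theorem tendsto_measureReal_rank_ne_zero [Fintype S] (X : ℕ → Ω → S) (rank : S → ℕ)
    (A : ℕ → Set Ω) (hA : Antitone A) (hX : ∀ t s, MeasurableSet {ω | X t ω = s})
    {q : ℝ} (hq : 0 < q) (hq1 : q ≤ 1) {e : ℕ → ℝ} (he : Tendsto e atTop (𝓝 0))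
    (he0 : ∀ t, 0 ≤ e t) (T : ℕ)
    (hdown : ∀ t ≥ T, ∀ s, rank s ≠ 0 → q * μ.real (A t ∩ {ω | X t ω = s}) ≤
      μ.real (A t ∩ {ω | X t ω = s} ∩ {ω | rank (X (t + 1) ω) < rank s}))
    (hstay : ∀ t ≥ T, ∀ s, rank s = 0 →
      μ.real (A t ∩ {ω | X t ω = s} ∩ {ω | rank (X (t + 1) ω) ≠ 0}) ≤
        e t * μ.real (A t ∩ {ω | X t ω = s})) :
    Tendsto (fun t => μ.real (A t ∩ {ω | rank (X t ω) ≠ 0})) atTop (𝓝 0) := by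
  classical
  -- The Lyapunov function is `1 - w (rank)`. The base `q / 2` is chosen so that a drop of rank with
  -- probability `q` at least doubles the expected weight: `q * w k = 2 * w (k + 1)`.
  obtain ⟨w, hw⟩ : ∃ w : ℕ → ℝ, w = fun k => (q / 2) ^ k := ⟨_, rfl⟩
  have hwpos : ∀ k, 0 < w k := fun k => by rw [hw]; positivity
  have hw0 : w 0 = 1 := by simp [hw]
  have hwanti : Antitone w := by
    rw [hw]; exact pow_right_anti₀ (by positivity) (by linarith)
  have hw1 : ∀ k, w k ≤ 1 := fun k => hw0 ▸ hwanti (Nat.zero_le k)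
  have hwhalf : ∀ k, k ≠ 0 → w k ≤ 1 / 2 := by
    intro k hk
    refine (hwanti (Nat.one_le_iff_ne_zero.2 hk)).trans ?_
    simp only [hw, pow_one]; linarith
  -- The sum of all ranks bounds each single rank, so `δ` is a positive lower bound for all weights;
  -- this uses that `S` is finite.
  obtain ⟨δ, hδ⟩ : ∃ δ, δ = w (∑ s, rank s) := ⟨_, rfl⟩
  have hδle : ∀ s, δ ≤ w (rank s) := by
    intro s
    rw [hδ]
    exact hwanti (Finset.single_le_sum (f := rank) (fun _ _ => Nat.zero_le _) (Finset.mem_univ s))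
  have hδpos : 0 < δ := hδ ▸ hwpos _
  have hδ1 : δ ≤ 1 := hδ ▸ hw1 _
  obtain ⟨v, hv⟩ : ∃ v : ℕ → ℝ,
      v = fun t => ∑ s, (1 - w (rank s)) * μ.real (A t ∩ {ω | X t ω = s}) := ⟨_, rfl⟩
  have hvnn : ∀ t, 0 ≤ v t := by
    intro t
    rw [hv]
    exact Finset.sum_nonneg fun s _ =>
      mul_nonneg (by linarith [hw1 (rank s)]) measureReal_nonneg
  have hsum : ∀ t (B : Set Ω), ∑ s, μ.real (B ∩ {ω | X t ω = s}) = μ.real B := by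
    intro t B
    rw [sum_measureReal_inter_eq (hX t)]; simp
  have hstep : ∀ t ≥ T, v (t + 1) ≤ (1 - δ) * v t + e t := by
    intro t ht
    -- As `A` decreases, replacing `A (t + 1)` by `A t` only increases the sum; afterwards every
    -- term lives on `A t`, where the transition bounds hold.
    have h1 : v (t + 1) ≤ ∑ s, ∑ s', (1 - w (rank s')) *
        μ.real (A t ∩ {ω | X t ω = s} ∩ {ω | X (t + 1) ω = s'}) := by
      rw [Finset.sum_comm]
      simp only [hv]
      refine Finset.sum_le_sum fun s' _ => ?_
      rw [← Finset.mul_sum]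
      refine mul_le_mul_of_nonneg_left ?_ (by linarith [hw1 (rank s')])
      have hcomm : ∀ s, A t ∩ {ω | X t ω = s} ∩ {ω | X (t + 1) ω = s'} =
          A t ∩ {ω | X (t + 1) ω = s'} ∩ {ω | X t ω = s} := fun s => Set.inter_right_comm _ _ _
      simp only [hcomm]
      rw [hsum]
      exact measureReal_mono (Set.inter_subset_inter_left _ (hA (Nat.le_succ t)))
    have h2 : ∀ s, ∑ s', (1 - w (rank s')) *
        μ.real (A t ∩ {ω | X t ω = s} ∩ {ω | X (t + 1) ω = s'}) ≤
        ((1 - δ) * (1 - w (rank s)) + e t) * μ.real (A t ∩ {ω | X t ω = s}) := by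
      intro s
      obtain ⟨B, hB⟩ : ∃ B, B = A t ∩ {ω | X t ω = s} := ⟨_, rfl⟩
      have hd := hdown t ht s
      have hs := hstay t ht s
      rw [← hB] at hd hs ⊢
      have hBnn : 0 ≤ μ.real B := measureReal_nonneg
      by_cases hr : rank s = 0
      · rw [hr, hw0, sub_self, mul_zero, zero_add]
        refine le_trans ?_ (hs hr)
        have : {ω | rank (X (t + 1) ω) ≠ 0} =
            {ω | X (t + 1) ω ∈ Finset.univ.filter fun s' => rank s' ≠ 0} := by ext; simp
        rw [this, ← sum_measureReal_inter_eq (hX (t + 1)), Finset.sum_filter]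
        refine Finset.sum_le_sum fun s' _ => ?_
        split_ifs with h
        · exact mul_le_of_le_one_left measureReal_nonneg (by linarith [hwpos (rank s')])
        · rw [not_not.1 h, hw0]; simp
      · have h3 : ∑ s', w (rank s') * μ.real (B ∩ {ω | X (t + 1) ω = s'}) ≥
            2 * w (rank s) * μ.real B := by
          obtain ⟨k, hk⟩ := Nat.exists_eq_succ_of_ne_zero hr
          have h4 : w k * (q * μ.real B) ≤
              ∑ s', w (rank s') * μ.real (B ∩ {ω | X (t + 1) ω = s'}) := by
            refine (mul_le_mul_of_nonneg_left (hd hr) (hwpos k).le).trans ?_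
            have : {ω | rank (X (t + 1) ω) < rank s} =
              {ω | X (t + 1) ω ∈ Finset.univ.filter fun s' => rank s' < rank s} := by ext; simp
            rw [this, ← sum_measureReal_inter_eq (hX (t + 1)), Finset.mul_sum,
              Finset.sum_filter]
            refine Finset.sum_le_sum fun s' _ => ?_
            split_ifs with h
            · exact mul_le_mul_of_nonneg_right (hwanti (by omega)) measureReal_nonneg
            · exact mul_nonneg (hwpos _).le measureReal_nonneg
          have h5 : 2 * w (rank s) = w k * q := by
            rw [hk, hw]; simp only [Nat.succ_eq_add_one, pow_succ]; ring
          rw [h5]; linarith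
        have h6 : ∑ s', (1 - w (rank s')) * μ.real (B ∩ {ω | X (t + 1) ω = s'}) =
            μ.real B - ∑ s', w (rank s') * μ.real (B ∩ {ω | X (t + 1) ω = s'}) := by
          simp only [sub_mul, one_mul, Finset.sum_sub_distrib, hsum]
        rw [h6]
        have h7 := mul_nonneg (he0 t) hBnn
        -- With `w ≥ δ` this says `0 ≤ w - δ + δ * w`, so doubling the weight contracts `1 - w` by
        -- the factor `1 - δ`.
        have h8 : 1 - 2 * w (rank s) ≤ (1 - δ) * (1 - w (rank s)) := by
          nlinarith [hδle s, hwpos (rank s), mul_pos hδpos (hwpos (rank s))]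
        have h9 := mul_le_mul_of_nonneg_right h8 hBnn
        nlinarith
    refine h1.trans ((Finset.sum_le_sum fun s _ => h2 s).trans ?_)
    simp only [add_mul, Finset.sum_add_distrib, mul_assoc]
    rw [← Finset.mul_sum, ← Finset.mul_sum, hsum]
    simp only [hv]
    have := mul_le_mul_of_nonneg_left (measureReal_le_one (μ := μ) (s := A t)) (he0 t)
    linarith
  have hv0 := tendsto_zero_of_contraction hδpos hδ1 hvnn he hstep
  refine squeeze_zero (fun t => measureReal_nonneg) (fun t => ?_)
    (by simpa using hv0.const_mul 2)
  have : {ω | rank (X t ω) ≠ 0} =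
    {ω | X t ω ∈ Finset.univ.filter fun s => rank s ≠ 0} := by ext; simp
  rw [this, ← sum_measureReal_inter_eq (hX t), Finset.sum_filter, hv, Finset.mul_sum]
  refine Finset.sum_le_sum fun s _ => ?_
  split_ifs with h
  · nlinarith [hwhalf _ h, measureReal_nonneg (μ := μ) (s := A t ∩ {ω | X t ω = s})]
  · rw [not_not.1 h, hw0]; simp

end Drift

variable {M N : ℕ} {G : Network M N} {P : Params M N}

/-! ### Measurability of the state -/

section Measurability

variable {Ω : Type*} {m₀ : MeasurableSpace Ω}

/-- Decisions take countably many values, so they may be frozen; what remains depends measurably on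
the estimates and gains. -/
theorem measurable_of_cases {α β : Type*} [Countable α] [MeasurableSpace β] {d : Ω → α}
    (hd : ∀ y, MeasurableSet {ω | d ω = y}) {F : α → Ω → β} (hF : ∀ y, Measurable (F y)) :
    Measurable fun ω => F (d ω) ω := by
  intro S hS
  have : (fun ω => F (d ω) ω) ⁻¹' S = ⋃ y, {ω | d ω = y} ∩ F y ⁻¹' S := by
    ext ω; simp
  rw [this]
  exact MeasurableSet.iUnion fun y => (hd y).inter (hF y hS)

/-- All components of the random state `s` are measurable. -/
structure StateMeasurable (m₀ : MeasurableSpace Ω) (s : Ω → State M N) : Prop where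
  Rhat : ∀ m n, Measurable[m₀] fun ω => (s ω).Rhat m n
  count : ∀ m n, Measurable[m₀] fun ω => (s ω).count m n
  αhat : ∀ m m' n, Measurable[m₀] fun ω => (s ω).αhat m m' n

theorem StateMeasurable.mono {s : Ω → State M N} {m₁ : MeasurableSpace Ω}
    (hs : StateMeasurable m₀ s) (h : m₀ ≤ m₁) : StateMeasurable m₁ s :=
  ⟨fun m n => (hs.Rhat m n).mono h le_rfl, fun m n => (hs.count m n).mono h le_rfl,
    fun m m' n => (hs.αhat m m' n).mono h le_rfl⟩

theorem Network.measurable_alloc (m : Fin M) : Measurable (G.alloc m) := by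
  unfold Network.alloc Network.rawAlloc
  fun_prop

theorem Network.measurable_relayRate (m : Fin M) (n : Fin N) :
    Measurable fun g : Gains M N => G.relayRate g m n := by
  unfold Network.relayRate
  fun_prop

theorem measurable_offer {s : Ω → State M N} (hs : StateMeasurable m₀ s)
    (y : Fin M → Decision N) (m : Fin M) : Measurable fun ω => offer G (s ω) y m := by
  unfold offer
  split_ifs with h
  · exact measurable_const
  · cases (y m).1 with
    | none => exact measurable_const
    | some n => exact (G.measurable_alloc m).comp (hs.Rhat m n)

theorem measurableSet_selects (b : Profile M N) {a : Ω → Fin M → ℝ}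
    (ha : ∀ m, Measurable fun ω => a ω m) (n : Fin N) (m : Fin M) :
    MeasurableSet {ω | G.Selects b (a ω) n m} := by
  have : {ω | G.Selects b (a ω) n m} = {_ω | b m = some n} ∩
      ⋂ m', ({_ω | b m' ≠ some n} ∪ ({ω | a ω m' < a ω m} ∪
        ({ω | a ω m' = a ω m} ∩ {_ω | G.prio n m' ≤ G.prio n m}))) := by
    ext ω
    simp only [Network.Selects, Set.mem_inter_iff, Set.mem_iInter, Set.mem_union,
      Set.mem_ofPred_eq]
    exact and_congr_right fun _ => forall_congr' fun m' => imp_iff_not_or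
  rw [this]
  exact (MeasurableSet.const _).inter (MeasurableSet.iInter fun m' =>
    (MeasurableSet.const _).union ((measurableSet_lt (ha m') (ha m)).union
      ((measurableSet_eq_fun (ha m') (ha m)).inter (MeasurableSet.const _))))

variable (G) in
/-- Pair `n` selects CU `m` in a period with previous state `s` and decisions `d`. -/
def Selected (s : State M N) (d : Fin M → Decision N) (n : Fin N) (m : Fin M) : Prop :=
  G.Selects (fun k => (d k).1) (offer G s d) n m

theorem measurableSet_selected {s : Ω → State M N} (hs : StateMeasurable m₀ s)
    {d : Ω → Fin M → Decision N} (hd : ∀ y, MeasurableSet {ω | d ω = y}) (n : Fin N)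
    (m : Fin M) : MeasurableSet {ω | Selected G (s ω) (d ω) n m} := by
  refine measurableSet_setOfPred.2 (measurable_of_cases (F := fun y ω => Selected G (s ω) y n m)
    hd fun y => measurableSet_setOfPred.1 ?_)
  exact measurableSet_selects _ (measurable_offer hs y) n m

theorem StateMeasurable.step {s : Ω → State M N} (hs : StateMeasurable m₀ s)
    {d : Ω → Fin M → Decision N} (hd : ∀ y, MeasurableSet {ω | d ω = y}) {g : Ω → Gains M N}
    (hg : Measurable g) : StateMeasurable m₀ fun ω => step G (s ω) (d ω) (g ω) := by
  have hI : ∀ (y : Fin M → Decision N) m n, Measurable fun ω =>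
      if G.choice (fun k => (y k).1) (offer G (s ω) y) n = some m then 1 else (0 : ℕ) := by
    intro y m n
    refine Measurable.ite ?_ measurable_const measurable_const
    simp only [Network.choice_eq_some_iff]
    exact measurableSet_selects _ (measurable_offer hs y) n m
  refine ⟨fun m n => ?_, fun m n => ?_, fun m m' n => ?_⟩
  · refine measurable_of_cases (F := fun y ω => (EBRIQ.step G (s ω) y (g ω)).Rhat m n)
      hd fun y => ?_
    have h1 := hs.Rhat m n
    have h2 := hs.count m n
    have h3 := hI y m n
    have h4 := (G.measurable_relayRate m n).comp hg
    have h5 : Measurable fun k : ℕ => (k : ℝ) := measurable_from_top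
    exact h1.add (((measurable_const.div (measurable_const.add (h5.comp (h2.add h3)))).mul
      (h5.comp h3)).mul (h4.sub h1))
  · refine measurable_of_cases (F := fun y ω => (EBRIQ.step G (s ω) y (g ω)).count m n)
      hd fun y => ?_
    exact (hs.count m n).add (hI y m n)
  · refine measurable_of_cases (F := fun y ω => (EBRIQ.step G (s ω) y (g ω)).αhat m m' n)
      hd fun y => ?_
    have ho := measurable_offer (G := G) hs y m'
    refine Measurable.ite ?_ ho (hs.αhat m m' n)
    exact (MeasurableSet.const _).inter (measurableSet_eq_fun ho measurable_const).compl

end Measurability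

/-! ### The estimates along a path -/

section Path

variable (d : ℕ → Fin M → Decision N) (g : ℕ → Gains M N)

open scoped Classical in
theorem count_stateAt (m : Fin M) (n : Fin N) (t : ℕ) :
    (stateAt G P d g (t + 1)).count m n = (initState G P).count m n +
      Nat.count (fun τ => Selected G (stateAt G P d g (τ + 1)) (d (τ + 2)) n m) t := by
  induction t with
  | zero => simp [stateAt]
  | succ t ih =>
    rw [Nat.count_succ, ← add_assoc, ← ih]
    simp only [stateAt, step, Network.choice_eq_some_iff]
    rfl

open scoped Classical in
-- Multiplied by `1 + count`, the update becomes additive. The estimate is thus an average in which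
-- the initial guess keeps a fixed weight. The count may start at `1`, from period 1, although that
-- period does not enter the estimate.
theorem Rhat_stateAt (m : Fin M) (n : Fin N) (t : ℕ) :
    (1 + ((stateAt G P d g (t + 1)).count m n : ℝ)) * (stateAt G P d g (t + 1)).Rhat m n =
      (1 + ((initState G P).count m n : ℝ)) * P.Rhat1 m n + ∑ τ ∈ Finset.range t,
        if Selected G (stateAt G P d g (τ + 1)) (d (τ + 2)) n m
          then G.relayRate (g (τ + 2)) m n else 0 := by
  induction t with
  | zero => simp [stateAt, initState]
  | succ t ih =>
    rw [Finset.sum_range_succ, ← add_assoc, ← ih]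
    obtain ⟨s, hs⟩ : ∃ s, s = stateAt G P d g (t + 1) := ⟨_, rfl⟩
    have hstep : stateAt G P d g (t + 1 + 1) = step G s (d (t + 2)) (g (t + 2)) := by
      rw [hs]; rfl
    rw [hstep, ← hs]
    by_cases h : Selected G s (d (t + 2)) n m
    · have h' := (G.choice_eq_some_iff _ _ _ _).2 h
      simp only [step, if_pos h, if_pos h']
      push_cast
      have : (1 + ((s.count m n : ℝ) + 1)) ≠ 0 := by positivity
      field_simp
      ring
    · have h' := mt (G.choice_eq_some_iff _ _ _ _).1 h
      simp only [step, if_neg h, if_neg h']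
      push_cast
      ring

theorem alloc_mem_Icc (hG : G.Standing) (m : Fin M) (R : ℝ) :
    G.alloc m R ∈ Set.Icc G.αL G.αU :=
  ⟨le_max_left _ _, max_le hG.αL_le_αU (min_le_right _ _)⟩

theorem alloc_lt_αe (hG : G.Standing) (m : Fin M) (R : ℝ) : G.alloc m R < G.αe := by
  have h1 := (alloc_mem_Icc hG m R).2
  have h2 := hG.θ'_pos
  unfold Network.αe
  linarith

/-- The decisions in which everybody proposes to `n` and exactly `m` offers `α_e`. -/
def boldDecision (m : Fin M) (n : Fin N) (k : Fin M) : Decision N := (some n, decide (k = m))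

/-- The offer `α_e` exceeds `αU`, hence every allocation, so even the CU ranked last by `n` is
selected and gets a sample. -/
theorem selected_boldDecision (hG : G.Standing) (s : State M N) (m : Fin M) (n : Fin N) :
    Selected G s (boldDecision m n) n m := by
  refine ⟨rfl, fun k _ => ?_⟩
  rcases eq_or_ne k m with rfl | hk
  · exact Or.inr ⟨rfl, le_rfl⟩
  · left
    simp only [offer, boldDecision, hk, decide_false, decide_true, if_true]
    exact alloc_lt_αe hG _ _

theorem tendsto_Rhat {m : Fin M} {n : Fin N}
    (hinf : {t | Selected G (stateAt G P d g (t + 1)) (d (t + 2)) n m}.Infinite)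
    (hlim : open scoped Classical in Tendsto (fun t => (∑ τ ∈ Finset.range t,
        if Selected G (stateAt G P d g (τ + 1)) (d (τ + 2)) n m
          then G.relayRate (g (τ + 2)) m n else 0) /
      (Nat.count (fun τ => Selected G (stateAt G P d g (τ + 1)) (d (τ + 2)) n m) t : ℝ))
      atTop (𝓝 (G.RC m n))) :
    Tendsto (fun t => (stateAt G P d g t).Rhat m n) atTop (𝓝 (G.RC m n)) := by
  classical
  rw [← tendsto_add_atTop_iff_nat 1]
  have hK := tendsto_natCast_atTop_atTop (R := ℝ) |>.comp (tendsto_count_atTop hinf)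
  obtain ⟨K, hKd⟩ : ∃ K : ℕ → ℝ, K = fun t => (Nat.count (fun τ =>
    Selected G (stateAt G P d g (τ + 1)) (d (τ + 2)) n m) t : ℝ) := ⟨_, rfl⟩
  have hK' : Tendsto K atTop atTop := by rw [hKd]; exact hK
  obtain ⟨c, hc⟩ : ∃ c : ℝ, c = 1 + ((initState G P).count m n : ℝ) := ⟨_, rfl⟩
  have hcpos : 0 < c := by rw [hc]; positivity
  have h1 : Tendsto (fun t => c * P.Rhat1 m n / K t) atTop (𝓝 0) :=
    tendsto_const_nhds.div_atTop hK'
  have h2 : Tendsto (fun t => c / K t) atTop (𝓝 0) := tendsto_const_nhds.div_atTop hK'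
  have h3 := (h1.add hlim).div (h2.add_const 1) (by norm_num)
  rw [zero_add, zero_add, div_one] at h3
  refine h3.congr' ?_
  filter_upwards [hK'.eventually_gt_atTop 0] with t ht
  have h4 := Rhat_stateAt (G := G) (P := P) d g m n t
  rw [count_stateAt] at h4
  push_cast at h4
  have h5 : (stateAt G P d g (t + 1)).Rhat m n = (c * P.Rhat1 m n + ∑ τ ∈ Finset.range t,
      if Selected G (stateAt G P d g (τ + 1)) (d (τ + 2)) n m
        then G.relayRate (g (τ + 2)) m n else 0) / (c + K t) := by
    rw [eq_div_iff (by positivity), hc, ← h4, hKd]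
    ring
  rw [h5]
  simp only [Pi.div_apply]
  have h6 : (Nat.count (fun τ =>
    Selected G (stateAt G P d g (τ + 1)) (d (τ + 2)) n m) t : ℝ) = K t := by rw [hKd]
  rw [h6]
  field_simp

variable {d g}

theorem continuousAt_rawAlloc (m : Fin M) {R : ℝ} (hR : R ≠ 0) :
    ContinuousAt (G.rawAlloc m) R := by
  unfold Network.rawAlloc
  have : 2 * R ≠ 0 := by positivity
  fun_prop (disch := assumption)

theorem continuousAt_alloc (m : Fin M) {R : ℝ} (hR : R ≠ 0) : ContinuousAt (G.alloc m) R := by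
  have := continuousAt_rawAlloc (G := G) m hR
  unfold Network.alloc
  fun_prop

/-- If the estimated allocations of `m'` with `n` end up in a set, so do all beliefs about them. -/
theorem eventually_αhat_mem (hG : G.Standing) {m m' : Fin M} {n : Fin N} {S : Set ℝ}
    (hS : ∀ᶠ t in atTop, alphaAt G P d g t m' n ∈ S)
    (hd : ∃ᶠ t in atTop, d t = fun _ => (some n, false)) :
    ∀ᶠ t in atTop, (stateAt G P d g t).αhat m m' n ∈ S := by
  classical
  obtain ⟨T, hT⟩ := eventually_atTop.1 hS
  -- A belief is either kept or replaced by an offer computed from the previous estimate; `α_e` is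
  -- never recorded. One refresh after `T` puts the belief in `S`, and it cannot leave.
  have hstep : ∀ t ≥ T, ((stateAt G P d g (t + 1)).αhat m m' n ∈ S ∨
      d (t + 2) = fun _ => (some n, false)) → (stateAt G P d g (t + 2)).αhat m m' n ∈ S := by
    intro t ht h
    have hnew : ∀ h1 : (d (t + 2) m').1 = some n, ∀ h2 : (d (t + 2) m').2 = false,
        offer G (stateAt G P d g (t + 1)) (d (t + 2)) m' ∈ S := by
      intro h1 h2
      have := hT (t + 1) (by omega)
      simpa [offer, h1, h2, alphaAt] using this
    simp only [stateAt, step]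
    split_ifs with hc
    · refine hnew hc.1 ?_
      by_contra h2
      exact hc.2 (by simp [offer, h2])
    · rcases h with h | h
      · exact h
      · refine absurd ⟨by simp [h], ?_⟩ hc
        have : offer G (stateAt G P d g (t + 1)) (d (t + 2)) m' =
          G.alloc m' ((stateAt G P d g (t + 1)).Rhat m' n) := by simp [offer, h]
        rw [this]
        exact (alloc_lt_αe hG _ _).ne
  obtain ⟨t₀, ht₀, hd₀⟩ := frequently_atTop.1 hd (T + 2)
  obtain ⟨t₁, rfl⟩ := Nat.exists_eq_add_of_le' (show 2 ≤ t₀ by omega)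
  refine eventually_atTop.2 ⟨t₁ + 2, fun t ht => ?_⟩
  induction t, ht using Nat.le_induction with
  | base => exact hstep t₁ (by omega) (Or.inr hd₀)
  | succ t ht ih =>
    obtain ⟨u, rfl⟩ := Nat.exists_eq_add_of_le' (show 1 ≤ t by omega)
    exact hstep u (by omega) (Or.inl ih)

variable (G) in
/-- Estimated utility of CU `m` when it is selected by `n`. -/
def estimatedUtility (s : State M N) (m : Fin M) (n : Fin N) : ℝ :=
  (1 - G.alloc m (s.Rhat m n)) * s.Rhat m n - G.RC₀ m - G.θ

variable (G) in
/-- The estimates in the state `s` order everything that matters correctly. -/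
structure Accurate (s : State M N) : Prop where
  neg : ∀ m n, ¬ 0 < G.UCstar m n → estimatedUtility G s m n < 0
  pos : ∀ m n, 0 < G.UCstar m n → 0 < estimatedUtility G s m n
  lt : ∀ m n n', 0 < G.UCstar m n → 0 < G.UCstar m n' → G.UCstar m n < G.UCstar m n' →
    estimatedUtility G s m n < estimatedUtility G s m n'
  merit : ∀ n m m', m ≠ m' → 0 < G.UCstar m n → 0 < G.UCstar m' n →
    ((s.αhat m m' n < G.alloc m (s.Rhat m n) ∨
      (s.αhat m m' n = G.alloc m (s.Rhat m n) ∧ G.prio n m' ≤ G.prio n m)) ↔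
        G.merit n m' ≤ G.merit n m)

theorem alloc_eq_αU (hG : G.Standing) {m : Fin M} {R : ℝ} (h : G.αU < G.rawAlloc m R) :
    G.alloc m R = G.αU := by
  rw [Network.alloc, min_eq_right h.le, max_eq_right hG.αL_le_αU]

theorem alloc_eq_αL {m : Fin M} {R : ℝ} (h : G.rawAlloc m R < G.αL) :
    G.alloc m R = G.αL := by
  rw [Network.alloc, max_eq_left ((min_le_left _ _).trans h.le)]

theorem tendsto_alphaAt (hG : G.Standing) {m : Fin M} {n : Fin N}
    (hR : Tendsto (fun t => (stateAt G P d g t).Rhat m n) atTop (𝓝 (G.RC m n))) :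
    Tendsto (fun t => alphaAt G P d g t m n) atTop (𝓝 (G.alphaStar m n)) :=
  (continuousAt_alloc m (hG.RC_pos m n).ne').tendsto.comp hR

/-- Strict inequalities pass from the limits to the estimates. The estimated utility tends to
`UCstar - θ`, which is never `0`: it is negative for unacceptable pairs and, as `θ` is small,
positive for acceptable ones. Exact ties of offers need a separate argument. -/
theorem eventually_accurate (hG : G.Standing) (hties : G.NoTies)
    (hR : ∀ m n, Tendsto (fun t => (stateAt G P d g t).Rhat m n) atTop (𝓝 (G.RC m n)))
    (hd : ∀ n, ∃ᶠ t in atTop, d t = fun _ => (some n, false)) :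
    ∀ᶠ t in atTop, Accurate G (stateAt G P d g t) := by
  have hu : ∀ m n, Tendsto (fun t => estimatedUtility G (stateAt G P d g t) m n) atTop
      (𝓝 (G.UCstar m n - G.θ)) := fun m n =>
    (((tendsto_const_nhds.sub (tendsto_alphaAt hG (hR m n))).mul (hR m n)).sub_const _).sub_const _
  have hθ := hG.θ_pos
  have h1 : ∀ m n, ∀ᶠ t in atTop, ¬ 0 < G.UCstar m n →
      estimatedUtility G (stateAt G P d g t) m n < 0 := fun m n => by
    by_cases h : 0 < G.UCstar m n
    · simp [h]
    · filter_upwards [(hu m n).eventually_lt_const (by linarith : _ < (0 : ℝ))] with t ht _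
      exact ht
  have h2 : ∀ m n, ∀ᶠ t in atTop, 0 < G.UCstar m n →
      0 < estimatedUtility G (stateAt G P d g t) m n := fun m n => by
    by_cases h : 0 < G.UCstar m n
    · have := hG.θ_small m n h
      filter_upwards [(hu m n).eventually_const_lt (by linarith : (0 : ℝ) < _)] with t ht _
      exact ht
    · simp [h]
  have h3 : ∀ m n n', ∀ᶠ t in atTop, G.UCstar m n < G.UCstar m n' →
      estimatedUtility G (stateAt G P d g t) m n <
        estimatedUtility G (stateAt G P d g t) m n' := fun m n n' => by
    by_cases h : G.UCstar m n < G.UCstar m n'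
    · filter_upwards [(hu m n).eventually_lt (hu m n') (by linarith)] with t ht _
      exact ht
    · simp [h]
  have h4 : ∀ n m m', ∀ᶠ t in atTop, m ≠ m' → 0 < G.UCstar m n → 0 < G.UCstar m' n →
    (((stateAt G P d g t).αhat m m' n < G.alloc m ((stateAt G P d g t).Rhat m n) ∨
      ((stateAt G P d g t).αhat m m' n = G.alloc m ((stateAt G P d g t).Rhat m n) ∧
        G.prio n m' ≤ G.prio n m)) ↔ G.merit n m' ≤ G.merit n m) := by
    intro n m m'
    by_cases hc : m ≠ m' ∧ 0 < G.UCstar m n ∧ 0 < G.UCstar m' n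
    swap
    · exact Eventually.of_forall fun t a b c => absurd ⟨a, b, c⟩ hc
    obtain ⟨hm, hp, hp'⟩ := hc
    simp only [G.merit_le_iff]
    have hα := tendsto_alphaAt hG (hR m n)
    have hα' := tendsto_alphaAt hG (hR m' n)
    rcases lt_trichotomy (G.alphaStar m' n) (G.alphaStar m n) with hlt | heq | hlt
    · obtain ⟨c, hc1, hc2⟩ := exists_between hlt
      -- Beliefs need not converge along with the current estimate, but they fall on the correct
      -- side of a separating constant `c`.
      filter_upwards [eventually_αhat_mem (m := m) (S := Set.Iio c) hG
        (hα'.eventually_lt_const hc1) (hd n), hα.eventually_const_lt hc2] with t ht1 ht2 _ _ _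
      exact iff_of_true (Or.inl (lt_trans ht1 ht2)) (Or.inl hlt)
    · have hraw : ∀ k, Tendsto (fun t => G.rawAlloc k ((stateAt G P d g t).Rhat k n)) atTop
          (𝓝 (G.rawAlloc k (G.RC k n))) := fun k =>
        (continuousAt_rawAlloc k (hG.RC_pos k n).ne').tendsto.comp (hR k n)
      -- For tied CUs both raw allocations lie strictly beyond the same end of the interval. The
      -- projections are then eventually equal to that end exactly, and the priority rule decides as
      -- it does under the true offers.
      have key : ∃ c, (∀ᶠ t in atTop, alphaAt G P d g t m n = c) ∧
          ∀ᶠ t in atTop, alphaAt G P d g t m' n = c := by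
        rcases hties.d2d n m m' hm hp hp' heq.symm with ⟨ha, hb⟩ | ⟨ha, hb⟩
        · refine ⟨G.αU, ?_, ?_⟩
          · filter_upwards [(hraw m).eventually_const_lt ha] with t ht using alloc_eq_αU hG ht
          · filter_upwards [(hraw m').eventually_const_lt hb] with t ht using alloc_eq_αU hG ht
        · refine ⟨G.αL, ?_, ?_⟩
          · filter_upwards [(hraw m).eventually_lt_const ha] with t ht using alloc_eq_αL ht
          · filter_upwards [(hraw m').eventually_lt_const hb] with t ht using alloc_eq_αL ht
      obtain ⟨c, hc1, hc2⟩ := key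
      filter_upwards [hc1, eventually_αhat_mem (m := m) (S := {c}) hG hc2 (hd n)]
        with t ht1 ht2 _ _ _
      simp only [alphaAt] at ht1
      rw [Set.mem_singleton_iff] at ht2
      rw [ht1, ht2]
      simp [heq]
    · obtain ⟨c, hc1, hc2⟩ := exists_between hlt
      filter_upwards [eventually_αhat_mem (m := m) (S := Set.Ioi c) hG
        (hα'.eventually_const_lt hc2) (hd n), hα.eventually_lt_const hc1] with t ht1 ht2 _ _ _
      have ht3 : G.alloc m ((stateAt G P d g t).Rhat m n) <
        (stateAt G P d g t).αhat m m' n := lt_trans ht2 ht1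
      refine iff_of_false ?_ ?_
      · rintro (h | ⟨h, _⟩)
        · exact lt_asymm h ht3
        · exact ht3.ne' h
      · rintro (h | ⟨h, _⟩)
        · exact lt_asymm h hlt
        · exact hlt.ne' h
  simp only [← eventually_all] at h1 h2 h3 h4
  filter_upwards [h1, h2, h3, h4] with t a b c e
  exact ⟨a, b, fun m n n' _ _ => c m n n', e⟩

end Path

/-! ### Decision probabilities -/

section Probabilities

variable (d : ℕ → Fin M → Decision N) (g : ℕ → Gains M N)

theorem Params.Valid.ε_nonneg (hP : P.Valid) (t : ℕ) : 0 ≤ P.ε t :=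
  mul_nonneg hP.ε₀_pos.le (Real.rpow_nonneg (Nat.cast_nonneg t) _)

theorem Params.Valid.ε_le_one (hP : P.Valid) {t : ℕ} (ht : 1 ≤ t) : P.ε t ≤ 1 := by
  refine mul_le_one₀ hP.ε₀_le (Real.rpow_nonneg (Nat.cast_nonneg t) _) ?_
  refine Real.rpow_le_one_of_one_le_of_nonpos (by exact_mod_cast ht) ?_
  exact div_nonpos_of_nonpos_of_nonneg (by norm_num) (by positivity)

theorem Params.Valid.tendsto_ε (hP : P.Valid) (hM : 0 < M) : Tendsto P.ε atTop (𝓝 0) := by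
  have hL : (0 : ℝ) < (M : ℝ) * (P.L : ℝ) := by
    have : 0 < P.L := hP.L_pos
    positivity
  have h := (tendsto_rpow_neg_atTop (div_pos one_pos hL)).comp
    (tendsto_natCast_atTop_atTop (R := ℝ))
  have h' := h.const_mul P.ε₀
  rw [mul_zero] at h'
  refine h'.congr fun t => ?_
  simp only [Function.comp, Params.ε, neg_div]

/-- `ε(t)^M = ε₀^M t^{-1/L}`, and `L ≥ 1`. This lower bound is what makes the series of exploration
probabilities diverge. -/
theorem Params.Valid.le_ε_pow (hP : P.Valid) (hM : 0 < M) {t : ℕ} (ht : 1 ≤ t) :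
    P.ε₀ ^ M * (1 / (t : ℝ)) ≤ P.ε t ^ M := by
  have ht' : (1 : ℝ) ≤ t := by exact_mod_cast ht
  have hL : (1 : ℝ) ≤ P.L := by exact_mod_cast hP.L_pos
  have hM' : (0 : ℝ) < M := by exact_mod_cast hM
  rw [Params.ε, mul_pow]
  refine mul_le_mul_of_nonneg_left ?_ (pow_nonneg hP.ε₀_pos.le _)
  rw [← Real.rpow_mul_natCast (by linarith), one_div, ← Real.rpow_neg_one]
  refine Real.rpow_le_rpow_of_exponent_le ht' ?_
  have : -1 / ((M : ℝ) * (P.L : ℝ)) * M = -(1 / (P.L : ℝ)) := by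
    have : (P.L : ℝ) ≠ 0 := by linarith
    field_simp
  rw [this, neg_le_neg_iff, div_le_one (by linarith)]
  exact hL

theorem exploreProb_nonneg (hP : P.Valid) (y : Decision N) : 0 ≤ exploreProb P y := by
  have h1 := hP.ζ_pos.le
  have h2 : 0 ≤ 1 - P.ζ := by linarith [hP.ζ_lt]
  have h3 : 0 ≤ 1 / (N : ℝ) := by positivity
  rcases y with ⟨_ | n, _ | _⟩
  · exact le_rfl
  · exact le_rfl
  · exact mul_nonneg h3 h1
  · exact mul_nonneg h3 h2

theorem le_exploreProb (hP : P.Valid) {y : Decision N} (hy : y.1 ≠ none) :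
    1 / (N : ℝ) * (P.ζ * (1 - P.ζ)) ≤ exploreProb P y := by
  have h1 := hP.ζ_pos
  have h2 := hP.ζ_lt
  have h3 : 0 ≤ 1 / (N : ℝ) := by positivity
  rcases y with ⟨_ | n, _ | _⟩
  · exact absurd rfl hy
  · exact absurd rfl hy
  · exact mul_le_mul_of_nonneg_left (by nlinarith) h3
  · exact mul_le_mul_of_nonneg_left (by nlinarith) h3

theorem replyProb_nonneg (t : ℕ) (m : Fin M) (x : Option (Fin N)) :
    0 ≤ replyProb G P d g t m x := by
  unfold replyProb
  split_ifs
  · exact ENNReal.toReal_nonneg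
  · exact zero_le_one
  · exact le_rfl

theorem exploitProb_nonneg (hP : P.Valid) (t : ℕ) (m : Fin M) (y : Decision N) :
    0 ≤ exploitProb G P d g t m y := by
  have h2 : 0 ≤ 1 - P.ξ := by linarith [hP.ξ_lt]
  rcases y with ⟨x, _ | _⟩
  · refine add_nonneg (mul_nonneg hP.ξ_pos.le ?_) (mul_nonneg h2 (replyProb_nonneg d g t m x))
    split_ifs <;> norm_num
  · exact le_rfl

theorem le_decisionProb_explore (hP : P.Valid) {t : ℕ} (ht : 1 ≤ t) (m : Fin M)
    (y : Decision N) : P.ε t * exploreProb P y ≤ decisionProb G P d g t m y :=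
  le_add_of_nonneg_right
    (mul_nonneg (by linarith [hP.ε_le_one ht]) (exploitProb_nonneg d g hP t m y))

theorem le_decisionProb_exploit (hP : P.Valid) (t : ℕ) (m : Fin M)
    (y : Decision N) : (1 - P.ε t) * exploitProb G P d g t m y ≤ decisionProb G P d g t m y :=
  le_add_of_nonneg_left (mul_nonneg (hP.ε_nonneg t) (exploreProb_nonneg hP y))

theorem pow_le_prod_decisionProb (hP : P.Valid) {t : ℕ} (ht : 1 ≤ t)
    {y : Fin M → Decision N} {c : ℝ} (hc : 0 ≤ c)
    (hy : ∀ m, c ≤ exploitProb G P d g t m (y m)) :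
    ((1 - P.ε t) * c) ^ M ≤ ∏ m, decisionProb G P d g t m (y m) := by
  have hε : 0 ≤ 1 - P.ε t := by linarith [hP.ε_le_one ht]
  have := Finset.prod_le_prod (s := Finset.univ) (f := fun _ : Fin M => (1 - P.ε t) * c)
    (g := fun m => decisionProb G P d g t m (y m)) (fun _ _ => mul_nonneg hε hc)
    fun m _ => (mul_le_mul_of_nonneg_left (hy m) hε).trans (le_decisionProb_exploit d g hP t m _)
  simpa using this

theorem ξ_le_exploitProb (hP : P.Valid) (t : ℕ) (m : Fin M) :
    P.ξ ≤ exploitProb G P d g t m (selection P d (t - 1) m, false) := by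
  have h2 : 0 ≤ 1 - P.ξ := by linarith [hP.ξ_lt]
  have := mul_nonneg h2 (replyProb_nonneg (G := G) (P := P) d g t m (selection P d (t - 1) m))
  simp only [exploitProb, if_true, mul_one]
  linarith

theorem exploitProb_of_betterReplies_empty {t : ℕ} {m : Fin M}
    (h : betterReplies G P d g t m = ∅) :
    exploitProb G P d g t m (selection P d (t - 1) m, false) = 1 := by
  simp [exploitProb, replyProb, h]

theorem le_exploitProb_of_mem_betterReplies (hP : P.Valid) {t : ℕ} {m : Fin M}
    {x : Option (Fin N)} (h : x ∈ betterReplies G P d g t m) :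
    (1 - P.ξ) * (P.reply m (betterReplies G P d g t m) x).toReal ≤
      exploitProb G P d g t m (x, false) := by
  have h1 : replyProb G P d g t m x = (P.reply m (betterReplies G P d g t m) x).toReal := by
    rw [replyProb, if_pos ⟨x, h⟩]
  simp only [exploitProb, h1]
  refine le_add_of_nonneg_left (mul_nonneg hP.ξ_pos.le ?_)
  split_ifs <;> norm_num

/-- There are finitely many triples `(m, S, x)`, so a minimum exists; the bound is uniform over all
histories. -/
theorem exists_reply_lower_bound (hP : P.Valid) :
    ∃ c : ℝ, 0 < c ∧ c ≤ 1 ∧ ∀ m S x, x ∈ S → c ≤ (P.reply m S x).toReal := by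
  classical
  let T := {p : Fin M × Finset (Option (Fin N)) × Option (Fin N) // p.2.2 ∈ p.2.1}
  have hpos : ∀ p : T, 0 < (P.reply p.1.1 p.1.2.1 p.1.2.2).toReal := by
    rintro ⟨⟨m, S, x⟩, hx⟩
    refine ENNReal.toReal_pos ?_ (PMF.apply_ne_top _ _)
    have : x ∈ (P.reply m S).support := by
      rw [hP.reply_support m S ⟨x, hx⟩]; exact hx
    exact (PMF.mem_support_iff _ _).1 this
  rcases isEmpty_or_nonempty T with hT | hT
  · exact ⟨1, one_pos, le_rfl, fun m S x hx => (hT.false ⟨(m, S, x), hx⟩).elim⟩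
  · obtain ⟨p, hp⟩ := Finite.exists_min fun p : T => (P.reply p.1.1 p.1.2.1 p.1.2.2).toReal
    refine ⟨_, hpos p, ?_, fun m S x hx => hp ⟨(m, S, x), hx⟩⟩
    exact ENNReal.toReal_le_of_le_ofReal zero_le_one (by simpa using PMF.coe_le_one _ _)

end Probabilities

/-! ### Better replies under accurate estimates -/

section Replies

variable {d : ℕ → Fin M → Decision N} {g : ℕ → Gains M N} {t : ℕ}

variable (G) in
/-- Under the estimates of CU `m` in the state `s`, pair `n` would select `m` against `b`. -/
def EstimatedWins (s : State M N) (b : Profile M N) (m : Fin M) (n : Fin N) : Prop :=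
  ∀ k, k ≠ m → b k = some n → s.αhat m k n < G.alloc m (s.Rhat m n) ∨
    (s.αhat m k n = G.alloc m (s.Rhat m n) ∧ G.prio n k ≤ G.prio n m)

theorem πhat_update_none (b : Profile M N) (m : Fin M) :
    πhat G P d g t m (Function.update b m none) = 0 := by
  simp [πhat]

open scoped Classical in
theorem πhat_update_some (ht : 2 ≤ t) (b : Profile M N) (m : Fin M) (n : Fin N) :
    πhat G P d g t m (Function.update b m (some n)) =
      if EstimatedWins G (stateAt G P d g t) b m n then
        estimatedUtility G (stateAt G P d g t) m n else -G.θ := by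
  have ht' : ¬ t ≤ 1 := by omega
  simp only [πhat, Function.update_self, if_neg ht', Network.choice_eq_some_iff]
  refine if_congr ?_ rfl rfl
  simp only [Network.Selects, Function.update_self, true_and, if_true]
  refine forall_congr' fun k => ?_
  rcases eq_or_ne k m with rfl | hk
  · simp
  · simp only [Function.update_of_ne hk, ne_eq, hk, not_false_eq_true,
      forall_const]
    refine imp_congr_right fun h => ?_
    rw [h]; rfl

/-- Accuracy compares offers only between acceptable pairs, so all proposals in `b` have to be
acceptable. This is why `Market.Step` withdraws unacceptable proposals before anything else. -/
theorem Accurate.estimatedWins_iff {s : State M N} (hs : Accurate G s) {b : Profile M N}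
    (hb : ∀ k, Market.Acceptable G.UCstar k (b k)) {m : Fin M} {n : Fin N}
    (hmn : 0 < G.UCstar m n) : EstimatedWins G s b m n ↔ Market.Wins G.merit b m n :=
  forall_congr' fun k => forall_congr' fun hk => forall_congr' fun h =>
    hs.merit n m k hk.symm hmn (hb k n h)

theorem πhat_neg_of_not_acceptable (hG : G.Standing) (ht : 2 ≤ t)
    (hs : Accurate G (stateAt G P d g t)) (b : Profile M N) {m : Fin M} {x : Option (Fin N)}
    (hx : ¬ Market.Acceptable G.UCstar m x) :
    πhat G P d g t m (Function.update b m x) < 0 := by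
  cases x with
  | none => exact absurd (Market.acceptable_none m) hx
  | some n =>
    rw [πhat_update_some ht]
    split_ifs
    · refine hs.neg m n fun h => hx fun j hj => ?_
      cases hj; exact h
    · linarith [hG.θ_pos]

/-- Both sides rank rejection below not proposing, and not proposing below an accepted acceptable
proposal; the numbers `-θ` and `-1` for rejection matter only through this order. -/
theorem πhat_lt_iff (hG : G.Standing) (hties : G.NoTies) (ht : 2 ≤ t)
    (hs : Accurate G (stateAt G P d g t)) {b : Profile M N}
    (hb : ∀ k, Market.Acceptable G.UCstar k (b k)) {m : Fin M} {x x' : Option (Fin N)}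
    (hx : Market.Acceptable G.UCstar m x) (hx' : Market.Acceptable G.UCstar m x') :
    πhat G P d g t m (Function.update b m x) < πhat G P d g t m (Function.update b m x') ↔
      Market.value G.UCstar G.merit b m x < Market.value G.UCstar G.merit b m x' := by
  have hθ := hG.θ_pos
  have hval : ∀ n, 0 < G.UCstar m n →
      (πhat G P d g t m (Function.update b m (some n)) =
          estimatedUtility G (stateAt G P d g t) m n ∧
        Market.value G.UCstar G.merit b m (some n) = G.UCstar m n) ∨
      (πhat G P d g t m (Function.update b m (some n)) = -G.θ ∧
        Market.value G.UCstar G.merit b m (some n) = -1) := by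
    intro n hn
    rw [πhat_update_some ht]
    by_cases h : Market.Wins G.merit b m n
    · left
      rw [if_pos ((hs.estimatedWins_iff hb hn).2 h), Market.value_some_of_wins h]
      exact ⟨rfl, rfl⟩
    · right
      rw [if_neg (mt (hs.estimatedWins_iff hb hn).1 h), Market.value_some_of_not_wins h]
      exact ⟨rfl, rfl⟩
  have hnone : Market.value G.UCstar G.merit b m none = 0 := rfl
  cases x with
  | none =>
    cases x' with
    | none => simp
    | some n =>
      have hn := hx' n rfl
      have hp := hs.pos m n hn
      rw [πhat_update_none, hnone]
      rcases hval n hn with ⟨h1, h2⟩ | ⟨h1, h2⟩ <;> rw [h1, h2]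
      · exact iff_of_true hp hn
      · exact iff_of_false (by linarith) (by norm_num)
  | some n =>
    have hn := hx n rfl
    have hp := hs.pos m n hn
    cases x' with
    | none =>
      rw [πhat_update_none, hnone]
      rcases hval n hn with ⟨h1, h2⟩ | ⟨h1, h2⟩ <;> rw [h1, h2]
      · exact iff_of_false hp.not_gt hn.not_gt
      · exact iff_of_true (by linarith) (by norm_num)
    | some n' =>
      have hn' := hx' n' rfl
      have hp' := hs.pos m n' hn'
      rcases hval n hn with ⟨h1, h2⟩ | ⟨h1, h2⟩ <;>
        rcases hval n' hn' with ⟨h3, h4⟩ | ⟨h3, h4⟩ <;> rw [h1, h2, h3, h4]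
      -- The converse needs strict preferences of the CU: with tied true utilities the estimates
      -- could order the two partners either way.
      · refine ⟨fun h => ?_, hs.lt m n n' hn hn'⟩
        by_contra hc
        rcases eq_or_ne n n' with rfl | hne
        · exact lt_irrefl _ h
        · have hlt := lt_of_le_of_ne (not_lt.1 hc) (hties.cu m n n' hne hn hn').symm
          exact lt_asymm h (hs.lt m n' n hn' hn hlt)
      · exact iff_of_false (by linarith) (by linarith)
      · exact iff_of_true (by linarith) (by linarith)
      · simp

/-- Number of periods (capped at `L`) for which the selections have been the same. -/
def steadiness (P : Params M N) (d : ℕ → Fin M → Decision N) : ℕ → ℕ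
  | 0 => 1
  | t + 1 => open scoped Classical in
    if selection P d (t + 1) = selection P d t then min P.L (steadiness P d t + 1) else 1

theorem steadiness_le (hP : P.Valid) : ∀ t, steadiness P d t ≤ P.L
  | 0 => hP.L_pos
  | t + 1 => by
    rw [steadiness]
    split_ifs
    · exact min_le_left _ _
    · exact hP.L_pos

theorem selection_eq_of_lt_steadiness {t τ : ℕ} (hτ : τ ≤ t) (h : t - τ < steadiness P d t) :
    selection P d τ = selection P d t := by
  induction t with
  | zero => rw [Nat.le_zero.1 hτ]
  | succ t ih =>
    rcases Nat.lt_or_ge t τ with h1 | h1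
    · rw [show τ = t + 1 by omega]
    · rw [steadiness] at h
      split_ifs at h with hc
      · rw [hc]
        exact ih h1 (by have := min_le_right P.L (steadiness P d t + 1); omega)
      · omega

/-- At full steadiness all remembered profiles coincide with the current one, so the total over the
memory is a positive multiple of a single term. -/
theorem mem_betterReplies_iff (hP : P.Valid) (ht : 1 ≤ t) (hL : steadiness P d t = P.L)
    (m : Fin M) (x : Option (Fin N)) :
    x ∈ betterReplies G P d g (t + 1) m ↔
      πhat G P d g t m (Function.update (selection P d t) m (selection P d t m)) <
        πhat G P d g t m (Function.update (selection P d t) m x) := by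
  have hval : ∀ x, memoryValue G P d g (t + 1) m x =
      ((Finset.Ico (max 1 (t + 1 - P.L)) (t + 1)).card : ℝ) *
        πhat G P d g t m (Function.update (selection P d t) m x) := by
    intro x
    rw [← nsmul_eq_mul, ← Finset.sum_const, memoryValue]
    refine Finset.sum_congr rfl fun τ hτ => ?_
    rw [Finset.mem_Ico, max_le_iff] at hτ
    rw [selection_eq_of_lt_steadiness (P := P) (d := d) (t := t) (τ := τ) (by omega)
      (by rw [hL]; have := hP.L_pos; omega)]
    rfl
  have hcard : (0 : ℝ) < ((Finset.Ico (max 1 (t + 1 - P.L)) (t + 1)).card : ℝ) := by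
    rw [Nat.cast_pos, Finset.card_pos, Finset.nonempty_Ico, max_lt_iff]
    have := hP.L_pos
    omega
  simp only [betterReplies, Finset.mem_filter, Finset.mem_univ, true_and, hval,
    Nat.add_sub_cancel]
  exact mul_lt_mul_iff_right₀ hcard

theorem mem_betterReplies_of_step (hG : G.Standing) (hties : G.NoTies) (hP : P.Valid)
    (ht : 2 ≤ t) (hs : Accurate G (stateAt G P d g t)) (hL : steadiness P d t = P.L)
    {b' : Profile M N} (h : Market.Step G.UCstar G.merit (selection P d t) b') :
    ∃ m x, b' = Function.update (selection P d t) m x ∧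
      x ∈ betterReplies G P d g (t + 1) m := by
  obtain ⟨m, x, rfl, h⟩ := h
  refine ⟨m, x, rfl, (mem_betterReplies_iff hP (by omega) hL m x).2 ?_⟩
  rcases h with ⟨h1, rfl⟩ | ⟨h1, h2, h3⟩
  · rw [πhat_update_none]
    exact πhat_neg_of_not_acceptable hG ht hs _ h1
  · exact (πhat_lt_iff hG hties ht hs h1 (h1 m) h2).2 h3

theorem betterReplies_eq_empty (hG : G.Standing) (hties : G.NoTies) (hP : P.Valid)
    (ht : 2 ≤ t) (hs : Accurate G (stateAt G P d g t)) (hL : steadiness P d t = P.L)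
    (h : Market.IsEquilibrium G.UCstar G.merit (selection P d t)) (m : Fin M) :
    betterReplies G P d g (t + 1) m = ∅ := by
  refine Finset.eq_empty_of_forall_notMem fun x hx => ?_
  rw [mem_betterReplies_iff hP (by omega) hL] at hx
  by_cases hacc : Market.Acceptable G.UCstar m x
  · exact (h.2 m x hacc).not_gt ((πhat_lt_iff hG hties ht hs h.1 (h.1 m) hacc).1 hx)
  -- An unacceptable better reply has negative estimated utility, so not proposing would be better
  -- still, against the equilibrium property.
  · have h1 := πhat_neg_of_not_acceptable hG ht hs (selection P d t) hacc
    have h2 := (πhat_lt_iff hG hties ht hs h.1 (h.1 m) (Market.acceptable_none m)).1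
      (by rw [πhat_update_none]; exact hx.trans h1)
    exact (h.2 m none (Market.acceptable_none m)).not_gt h2

end Replies

/-! ### Runs of the algorithm -/

namespace IsRun

variable {Ω : Type*} {mΩ : MeasurableSpace Ω} {μ : Measure Ω} {ℱ : Filtration ℕ mΩ}
  {D : ℕ → Ω → Fin M → Decision N} {g : ℕ → Ω → Gains M N}

theorem measurableSet_decision (hrun : IsRun G P μ ℱ D g) {t : ℕ} (ht : 2 ≤ t)
    (y : Fin M → Decision N) : MeasurableSet[ℱ t] {ω | D t ω = y} :=
  hrun.decision_adapted t ht (show MeasurableSet[⊤] {y} from trivial)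

theorem stateMeasurable (hrun : IsRun G P μ ℱ D g) : ∀ t,
    StateMeasurable (ℱ t) fun ω => stateAt G P (fun τ => D τ ω) (fun τ => g τ ω) t
  | 0 => ⟨fun _ _ => measurable_const, fun _ _ => measurable_const,
      fun _ _ _ => measurable_const⟩
  | 1 => ⟨fun _ _ => measurable_const, fun _ _ => measurable_const,
      fun _ _ _ => measurable_const⟩
  | t + 2 => StateMeasurable.step ((hrun.stateMeasurable (t + 1)).mono (ℱ.mono (Nat.le_succ _)))
      (hrun.measurableSet_decision (by omega)) (hrun.gains_adapted (t + 2) (by omega))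

theorem measurableSet_selection (hrun : IsRun G P μ ℱ D g) (t : ℕ) (b : Profile M N) :
    MeasurableSet[ℱ t] {ω | selection P (fun τ => D τ ω) t = b} := by
  unfold selection
  split_ifs with h
  · exact MeasurableSet.const _
  · have : {ω | (fun m => (D t ω m).1) = b} =
        ⋃ y : {y : Fin M → Decision N // (fun m => (y m).1) = b}, {ω | D t ω = y} := by
      ext ω; simp
    rw [this]
    exact MeasurableSet.iUnion fun y => hrun.measurableSet_decision (by omega) _

theorem measurableSet_steadiness (hrun : IsRun G P μ ℱ D g) (t c : ℕ) :
    MeasurableSet[ℱ t] {ω | steadiness P (fun τ => D τ ω) t = c} := by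
  induction t generalizing c with
  | zero => exact MeasurableSet.const (1 = c)
  | succ t ih =>
    have hle := ℱ.mono (Nat.le_succ t)
    have hst : Measurable[ℱ (t + 1)] fun ω => steadiness P (fun τ => D τ ω) t :=
      @measurable_to_countable' _ _ _ _ (ℱ (t + 1)) _ fun k => hle _ (ih k)
    have hsel : MeasurableSet[ℱ (t + 1)] {ω | selection P (fun τ => D τ ω) (t + 1) =
        selection P (fun τ => D τ ω) t} := by
      have : {ω | selection P (fun τ => D τ ω) (t + 1) = selection P (fun τ => D τ ω) t} =
          ⋃ b, {ω | selection P (fun τ => D τ ω) (t + 1) = b} ∩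
            {ω | selection P (fun τ => D τ ω) t = b} := by
        ext ω; simp [eq_comm]
      rw [this]
      exact MeasurableSet.iUnion fun b => (hrun.measurableSet_selection (t + 1) b).inter
        (hle _ (hrun.measurableSet_selection t b))
    have : Measurable[ℱ (t + 1)] fun ω => steadiness P (fun τ => D τ ω) (t + 1) := by
      simp only [steadiness]
      exact Measurable.ite hsel (measurable_const.min (hst.add measurable_const)) measurable_const
    exact this (measurableSet_singleton c)

theorem measurableSet_accurate (hrun : IsRun G P μ ℱ D g) (t : ℕ) : MeasurableSet[ℱ t]
    {ω | Accurate G (stateAt G P (fun τ => D τ ω) (fun τ => g τ ω) t)} := by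
  obtain ⟨s, hs⟩ : ∃ s : Ω → State M N,
    s = fun ω => stateAt G P (fun τ => D τ ω) (fun τ => g τ ω) t := ⟨_, rfl⟩
  have hm : StateMeasurable (ℱ t) s := hs ▸ hrun.stateMeasurable t
  have hset : {ω | Accurate G (stateAt G P (fun τ => D τ ω) (fun τ => g τ ω) t)} =
      {ω | Accurate G (s ω)} := by rw [hs]
  rw [hset]
  have ha : ∀ m n, Measurable[ℱ t] fun ω => G.alloc m ((s ω).Rhat m n) :=
    fun m n => (G.measurable_alloc m).comp (hm.Rhat m n)
  have hu : ∀ m n, Measurable[ℱ t] fun ω => estimatedUtility G (s ω) m n := fun m n =>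
    (((measurable_const.sub (ha m n)).mul (hm.Rhat m n)).sub measurable_const).sub
      measurable_const
  have himp : ∀ (p : Prop) {S : Set Ω}, MeasurableSet[ℱ t] S →
      MeasurableSet[ℱ t] {ω | p → ω ∈ S} := by
    intro p S hS
    by_cases h : p
    · simpa [h] using hS
    · simp [h]
  have heq : {ω | Accurate G (s ω)} =
      ((⋂ m, ⋂ n, {ω | ¬ 0 < G.UCstar m n → ω ∈ {ω | estimatedUtility G (s ω) m n < 0}}) ∩
      (⋂ m, ⋂ n, {ω | 0 < G.UCstar m n → ω ∈ {ω | 0 < estimatedUtility G (s ω) m n}})) ∩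
      ((⋂ m, ⋂ n, ⋂ n', {ω | (0 < G.UCstar m n ∧ 0 < G.UCstar m n' ∧
        G.UCstar m n < G.UCstar m n') →
          ω ∈ {ω | estimatedUtility G (s ω) m n < estimatedUtility G (s ω) m n'}}) ∩
      (⋂ n, ⋂ m, ⋂ m', {ω | (m ≠ m' ∧ 0 < G.UCstar m n ∧ 0 < G.UCstar m' n) →
        ω ∈ {ω | ((s ω).αhat m m' n < G.alloc m ((s ω).Rhat m n) ∨
          ((s ω).αhat m m' n = G.alloc m ((s ω).Rhat m n) ∧ G.prio n m' ≤ G.prio n m)) ↔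
            G.merit n m' ≤ G.merit n m}})) := by
    ext ω
    simp only [Set.mem_inter_iff, Set.mem_iInter, Set.mem_ofPred_eq, and_imp]
    exact ⟨fun h => ⟨⟨h.neg, h.pos⟩, h.lt, h.merit⟩,
      fun h => ⟨h.1.1, h.1.2, h.2.1, h.2.2⟩⟩
  rw [heq]
  refine MeasurableSet.inter (MeasurableSet.inter ?_ ?_) (MeasurableSet.inter ?_ ?_)
  · exact MeasurableSet.iInter fun m => MeasurableSet.iInter fun n =>
      himp _ (measurableSet_lt (hu m n) measurable_const)
  · exact MeasurableSet.iInter fun m => MeasurableSet.iInter fun n =>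
      himp _ (measurableSet_lt measurable_const (hu m n))
  · exact MeasurableSet.iInter fun m => MeasurableSet.iInter fun n => MeasurableSet.iInter
      fun n' => himp _ (measurableSet_lt (hu m n) (hu m n'))
  · refine MeasurableSet.iInter fun n => MeasurableSet.iInter fun m => MeasurableSet.iInter
      fun m' => himp _ ?_
    have h1 : MeasurableSet[ℱ t] {ω | (s ω).αhat m m' n < G.alloc m ((s ω).Rhat m n) ∨
        ((s ω).αhat m m' n = G.alloc m ((s ω).Rhat m n) ∧ G.prio n m' ≤ G.prio n m)} :=
      (measurableSet_lt (hm.αhat m m' n) (ha m n)).union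
        ((measurableSet_eq_fun (hm.αhat m m' n) (ha m n)).inter (MeasurableSet.const _))
    by_cases h : G.merit n m' ≤ G.merit n m
    · simpa only [h, iff_true] using h1
    · simp only [h, iff_false]
      exact h1.compl

variable [IsProbabilityMeasure μ]

/-- Integrate the conditional law of the decision over the past event `E`. -/
theorem mul_measureReal_le (hrun : IsRun G P μ ℱ D g) {t : ℕ} (ht : 1 ≤ t) {E : Set Ω}
    (hE : MeasurableSet[ℱ t] E) (y : Fin M → Decision N) {p : ℝ}
    (hp : ∀ ω ∈ E, p ≤ ∏ m, decisionProb G P (fun τ => D τ ω) (fun τ => g τ ω) (t + 1) m (y m)) :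
    p * μ.real E ≤ μ.real (E ∩ {ω | D (t + 1) ω = y}) := by
  have hE' : MeasurableSet E := ℱ.le t _ hE
  have hy : MeasurableSet {ω | D (t + 1) ω = y} :=
    ℱ.le _ _ (hrun.measurableSet_decision (by omega) y)
  have hint : Integrable (Set.indicator {ω | D (t + 1) ω = y} fun _ => (1 : ℝ)) μ :=
    (integrable_const 1).indicator hy
  have h1 : ∫ ω in E, (μ[Set.indicator {ω | D (t + 1) ω = y} fun _ => (1 : ℝ) | ℱ t]) ω ∂μ =
      μ.real (E ∩ {ω | D (t + 1) ω = y}) := by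
    rw [setIntegral_condExp (ℱ.le t) hint hE, setIntegral_indicator hy]
    simp
  rw [← h1]
  have h2 : p * μ.real E = ∫ _ in E, p ∂μ := by simp [mul_comm]
  rw [h2]
  refine setIntegral_mono_on_ae (integrable_const p).integrableOn
    integrable_condExp.integrableOn hE' ?_
  filter_upwards [hrun.decision_law (t + 1) (by omega) y] with ω hω hωE
  exact (hp ω hωE).trans (le_of_eq hω.symm)

theorem ae_frequently_eq (hrun : IsRun G P μ ℱ D g) (hP : P.Valid) (hM : 0 < M) (hN : 0 < N)
    (y : Fin M → Decision N) (hy : ∀ m, (y m).1 ≠ none) :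
    ∀ᵐ ω ∂μ, ∃ᶠ t in atTop, D t ω = y := by
  let ℱ' : Filtration ℕ mΩ :=
    ⟨fun t => ℱ (t + 2), fun _ _ h => ℱ.mono (by omega), fun t => ℱ.le _⟩
  have hs : ∀ t, MeasurableSet[ℱ' t] {ω | D (t + 2) ω = y} :=
    fun t => hrun.measurableSet_decision (by omega) y
  obtain ⟨C, hC⟩ : ∃ C : ℝ, C = P.ε₀ ^ M * (1 / (N : ℝ) * (P.ζ * (1 - P.ζ))) ^ M := ⟨_, rfl⟩
  have hNpos : (0 : ℝ) < N := by exact_mod_cast hN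
  have hζ : 0 < 1 / (N : ℝ) * (P.ζ * (1 - P.ζ)) :=
    mul_pos (by positivity) (mul_pos hP.ζ_pos (by linarith [hP.ζ_lt]))
  have hCpos : 0 < C := hC ▸ mul_pos (pow_pos hP.ε₀_pos _) (pow_pos hζ _)
  have hlaw : ∀ᵐ ω ∂μ, ∀ k : ℕ, C / 3 * (1 / ((k : ℝ) + 1)) ≤
      (μ[({ω | D (k + 1 + 2) ω = y}).indicator (1 : Ω → ℝ) | ℱ' k]) ω := by
    refine ae_all_iff.2 fun k => ?_
    filter_upwards [hrun.decision_law (k + 1 + 2) (by omega) y] with ω hω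
    refine le_trans ?_ (le_of_eq hω.symm)
    have h1 := Finset.prod_le_prod (s := Finset.univ)
      (f := fun _ : Fin M => P.ε (k + 3) * (1 / (N : ℝ) * (P.ζ * (1 - P.ζ))))
      (g := fun m => decisionProb G P (fun τ => D τ ω) (fun τ => g τ ω) (k + 3) m (y m))
      (fun _ _ => mul_nonneg (hP.ε_nonneg _) hζ.le)
      fun m _ => (mul_le_mul_of_nonneg_left (le_exploreProb hP (hy m)) (hP.ε_nonneg _)).trans
        (le_decisionProb_explore _ _ hP (by omega) m _)
    refine le_trans ?_ h1
    rw [Finset.prod_const, Finset.card_univ, Fintype.card_fin, mul_pow]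
    have h2 := mul_le_mul_of_nonneg_right (hP.le_ε_pow hM (show 1 ≤ k + 3 by omega))
      (pow_nonneg hζ.le M)
    refine le_trans ?_ h2
    -- The factor `1 / 3` absorbs the index shift: `k + 3 ≤ 3 * (k + 1)`.
    have h3 : (1 : ℝ) / 3 * (1 / ((k : ℝ) + 1)) ≤ 1 / ((k + 3 : ℕ) : ℝ) := by
      rw [one_div_mul_one_div]
      refine one_div_le_one_div_of_le (by positivity) ?_
      push_cast
      have : (0 : ℝ) ≤ k := Nat.cast_nonneg k
      linarith
    calc C / 3 * (1 / ((k : ℝ) + 1)) = C * (1 / 3 * (1 / ((k : ℝ) + 1))) := by ring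
      _ ≤ C * (1 / ((k + 3 : ℕ) : ℝ)) := mul_le_mul_of_nonneg_left h3 hCpos.le
      _ = _ := by rw [hC]; ring
  filter_upwards [ae_mem_limsup_atTop_iff μ hs, hlaw] with ω h1 h2
  have h3 : Tendsto (fun n => ∑ k ∈ Finset.range n,
      (μ[({ω | D (k + 1 + 2) ω = y}).indicator (1 : Ω → ℝ) | ℱ' k]) ω) atTop atTop := by
    have h4 := Real.tendsto_sum_range_one_div_nat_succ_atTop.const_mul_atTop
      (show 0 < C / 3 by positivity)
    refine tendsto_atTop_mono (fun n => ?_) h4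
    rw [Finset.mul_sum]
    exact Finset.sum_le_sum fun k _ => h2 k
  have h5 := mem_limsup_iff_frequently_mem.1 (h1.2 h3)
  exact (tendsto_add_atTop_nat 2).frequently h5

theorem ae_tendsto_Rhat (hrun : IsRun G P μ ℱ D g) (hG : G.Standing) (hP : P.Valid)
    (hN : 0 < N) (m : Fin M) (n : Fin N) :
    ∀ᵐ ω ∂μ, Tendsto (fun t => (stateAt G P (fun τ => D τ ω) (fun τ => g τ ω) t).Rhat m n)
      atTop (𝓝 (G.RC m n)) := by
  have hgm : ∀ t, 2 ≤ t → Measurable (g t) := fun t ht =>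
    (hrun.gains_adapted t ht).mono (ℱ.le t) le_rfl
  have hf := G.measurable_relayRate m n
  -- `H t` contains the past and the decisions of period `t + 2` but need not contain its gains:
  -- whether `n` selects `m` is known to `H t`, while the sample of that period is independent of
  -- it.
  let H : ℕ → MeasurableSpace Ω := fun t => ℱ (t + 1) ⊔ MeasurableSpace.comap (D (t + 2)) ⊤
  have hHℱ : ∀ t, H t ≤ ℱ (t + 2) := fun t =>
    sup_le (ℱ.mono (by omega)) (hrun.decision_adapted (t + 2) (by omega)).comap_le
  have hℱH : ∀ t, ℱ (t + 2) ≤ H (t + 1) := fun t => le_sup_left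
  let s : ℕ → Set Ω := fun t =>
    {ω | Selected G (stateAt G P (fun τ => D τ ω) (fun τ => g τ ω) (t + 1)) (D (t + 2) ω) n m}
  let r : ℕ → Ω → ℝ := fun t ω => G.relayRate (g (t + 2) ω) m n
  have hs : ∀ t, MeasurableSet[H t] (s t) := fun t =>
    measurableSet_selected ((hrun.stateMeasurable (t + 1)).mono le_sup_left)
      (fun y => (le_sup_right : MeasurableSpace.comap (D (t + 2)) ⊤ ≤ H t) _ ⟨{y}, trivial, rfl⟩)
      n m
  have hr : ∀ t, Measurable[H (t + 1)] (r t) := fun t =>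
    hf.comp ((hrun.gains_adapted (t + 2) (by omega)).mono (hℱH t) le_rfl)
  have hgid : ∀ t, IdentDistrib (g (t + 2)) (g 2) μ μ := fun t =>
    ⟨(hgm _ (by omega)).aemeasurable, (hgm _ le_rfl).aemeasurable, by
      rw [hrun.gains_law _ (by omega), hrun.gains_law _ le_rfl]⟩
  have hid : ∀ t, IdentDistrib (r t) (r 0) μ μ := fun t => (hgid t).comp hf
  have hlaw := hrun.gains_law 2 le_rfl
  have hint : Integrable (r 0) μ := by
    have h := hG.relay_integrable m n
    rw [← hlaw] at h
    exact (integrable_map_measure hf.aestronglyMeasurable (hgm 2 le_rfl).aemeasurable).1 h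
  have hmean : ∫ ω, r 0 ω ∂μ = G.RC m n := by
    rw [Network.RC, ← hlaw, integral_map (hgm 2 le_rfl).aemeasurable hf.aestronglyMeasurable]
  have hindep : ∀ t, Indep (MeasurableSpace.comap (r t) inferInstance) (H t) μ := by
    intro t
    refine indep_of_indep_of_le_left (hrun.gains_indep (t + 2) (by omega)) ?_
    rintro _ ⟨B, hB, rfl⟩
    exact ⟨_, hf hB, rfl⟩
  have hinf : ∀ᵐ ω ∂μ, {t | ω ∈ s t}.Infinite := by
    filter_upwards [hrun.ae_frequently_eq hP (Fin.pos m) hN (boldDecision m n)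
      fun _ => by simp [boldDecision]] with ω hω
    rw [← Nat.frequently_atTop_iff_infinite]
    have h2 : ∃ᶠ t in atTop, D (t + 2) ω = boldDecision m n := by
      refine frequently_atTop.2 fun a => ?_
      obtain ⟨b, hb, hbD⟩ := frequently_atTop.1 hω (a + 2)
      obtain ⟨c, rfl⟩ := Nat.exists_eq_add_of_le' (show 2 ≤ b by omega)
      exact ⟨c, by omega, hbD⟩
    refine h2.mono fun t ht => ?_
    change Selected G _ (D (t + 2) ω) n m
    rw [ht]
    exact selected_boldDecision hG _ m n
  filter_upwards [strong_law_optional_skipping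
    (monotone_nat_of_le_succ fun t => (hHℱ t).trans (hℱH t)) (fun t => (hHℱ t).trans (ℱ.le _))
    hs hr hid hint hindep hinf, hinf] with ω h1 h2
  rw [hmean] at h1
  exact tendsto_Rhat _ _ h2 h1

theorem ae_eventually_accurate (hrun : IsRun G P μ ℱ D g) (hG : G.Standing)
    (hties : G.NoTies) (hP : P.Valid) (hM : 0 < M) (hN : 0 < N) :
    ∀ᵐ ω ∂μ, ∀ᶠ t in atTop,
      Accurate G (stateAt G P (fun τ => D τ ω) (fun τ => g τ ω) t) := by
  have h1 : ∀ᵐ ω ∂μ, ∀ m n, Tendsto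
      (fun t => (stateAt G P (fun τ => D τ ω) (fun τ => g τ ω) t).Rhat m n)
      atTop (𝓝 (G.RC m n)) :=
    ae_all_iff.2 fun m => ae_all_iff.2 fun n => hrun.ae_tendsto_Rhat hG hP hN m n
  have h2 : ∀ᵐ ω ∂μ, ∀ n : Fin N, ∃ᶠ t in atTop, D t ω = fun _ => (some n, false) :=
    ae_all_iff.2 fun n => hrun.ae_frequently_eq hP hM hN _ fun _ => by simp
  filter_upwards [h1, h2] with ω h3 h4
  exact eventually_accurate hG hties h3 h4

theorem tendsto_accurate_from (hrun : IsRun G P μ ℱ D g) (hG : G.Standing)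
    (hties : G.NoTies) (hP : P.Valid) (hM : 0 < M) (hN : 0 < N) :
    Tendsto (fun T => μ.real {ω | ∀ t ≥ T,
      Accurate G (stateAt G P (fun τ => D τ ω) (fun τ => g τ ω) t)}) atTop (𝓝 1) := by
  have hmono : Monotone fun T => {ω | ∀ t ≥ T,
      Accurate G (stateAt G P (fun τ => D τ ω) (fun τ => g τ ω) t)} :=
    fun T T' h ω hω t ht => hω t (h.trans ht)
  have h1 := tendsto_measure_iUnion_atTop (μ := μ) hmono
  have h2 : μ (⋃ T, {ω | ∀ t ≥ T,
      Accurate G (stateAt G P (fun τ => D τ ω) (fun τ => g τ ω) t)}) = 1 := by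
    rw [← measure_univ (μ := μ)]
    refine measure_congr ?_
    filter_upwards [hrun.ae_eventually_accurate hG hties hP hM hN] with ω hω
    refine propext ⟨fun _ => trivial, fun _ => ?_⟩
    obtain ⟨T, hT⟩ := eventually_atTop.1 hω
    exact Set.mem_iUnion.2 ⟨T, hT⟩
  rw [h2] at h1
  exact (ENNReal.tendsto_toReal ENNReal.one_ne_top).comp h1

/-- While the estimates are accurate, the selections settle in equilibria. -/
theorem tendsto_unsettled (hrun : IsRun G P μ ℱ D g) (hG : G.Standing)
    (hties : G.NoTies) (hP : P.Valid) (hM : 0 < M) (T : ℕ) :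
    Tendsto (fun t => μ.real ({ω | ∀ τ, T ≤ τ → τ ≤ t →
        Accurate G (stateAt G P (fun τ => D τ ω) (fun τ => g τ ω) τ)} ∩
      {ω | ¬ Market.IsEquilibrium G.UCstar G.merit (selection P (fun τ => D τ ω) t)}))
      atTop (𝓝 0) := by
  obtain ⟨rank, hrank⟩ := Market.exists_rank (u := G.UCstar) G.merit_injective
  obtain ⟨c, hc, hc1, hreply⟩ := exists_reply_lower_bound hP
  have hLpos := hP.L_pos
  have hξ := hP.ξ_pos
  have hξ1 := hP.ξ_lt
  obtain ⟨p, hp, hp1, hpξ, hpc⟩ : ∃ p : ℝ, 0 < p ∧ p ≤ 1 ∧ p ≤ P.ξ ∧ p ≤ (1 - P.ξ) * c :=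
    ⟨min P.ξ ((1 - P.ξ) * c), lt_min hξ (mul_pos (by linarith) hc),
      (min_le_left _ _).trans hξ1.le, min_le_left _ _, min_le_right _ _⟩
  let A : ℕ → Set Ω := fun t => {ω | ∀ τ, T ≤ τ → τ ≤ t →
    Accurate G (stateAt G P (fun τ => D τ ω) (fun τ => g τ ω) τ)}
  let X : ℕ → Ω → Profile M N × Fin (P.L + 1) := fun t ω =>
    (selection P (fun τ => D τ ω) t,
      ⟨steadiness P (fun τ => D τ ω) t, Nat.lt_succ_of_le (steadiness_le hP t)⟩)
  -- Distance to equilibrium counts `L` times. A revision resets the steadiness to `1`, which costs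
  -- at most `L - 1`, so lowering the distance by one still lowers the total.
  let h : Profile M N × Fin (P.L + 1) → ℕ := fun s => P.L * rank s.1 + (P.L - s.2)
  have hAm : ∀ t, MeasurableSet[ℱ t] (A t) := by
    intro t
    have : A t = ⋂ τ : Fin (t + 1), {ω | T ≤ (τ : ℕ) → ω ∈ {ω | Accurate G
        (stateAt G P (fun τ => D τ ω) (fun τ => g τ ω) τ)}} := by
      ext ω
      simp only [A, Set.mem_iInter, Set.mem_ofPred_eq]
      exact ⟨fun h τ hτ => h τ hτ (Nat.le_of_lt_succ τ.2),
        fun h τ hT ht => h ⟨τ, Nat.lt_succ_of_le ht⟩ hT⟩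
    rw [this]
    refine MeasurableSet.iInter fun τ => ?_
    have hτ := ℱ.mono (Nat.le_of_lt_succ τ.2) _ (hrun.measurableSet_accurate (τ : ℕ))
    by_cases hT : T ≤ (τ : ℕ)
    · simp only [hT, forall_const]
      exact hτ
    · simp [hT]
  have hXm : ∀ t s, MeasurableSet[ℱ t] {ω | X t ω = s} := by
    rintro t ⟨b, k⟩
    have : {ω | X t ω = (b, k)} = {ω | selection P (fun τ => D τ ω) t = b} ∩
        {ω | steadiness P (fun τ => D τ ω) t = k} := by
      ext ω
      simp [X, Fin.ext_iff]
    rw [this]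
    exact (hrun.measurableSet_selection t b).inter (hrun.measurableSet_steadiness t k)
  have hε := (hP.tendsto_ε hM).comp (tendsto_add_atTop_nat 1)
  obtain ⟨T₁, hT₁⟩ := eventually_atTop.1
    (hε.eventually_lt_const (show (0 : ℝ) < 1 / 2 by norm_num))
  have hselnext : ∀ (t : ℕ) (ω : Ω) (b : Profile M N), 1 ≤ t →
      D (t + 1) ω = (fun m => (b m, false)) → selection P (fun τ => D τ ω) (t + 1) = b := by
    intro t ω b ht hD
    simp only [selection, hD]
    rw [if_neg (by omega)]
  have hlim := tendsto_measureReal_rank_ne_zero (μ := μ) X h A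
    (fun t t' htt ω hω τ h1 h2 => hω τ h1 (h2.trans htt))
    (fun t s => ℱ.le t _ (hXm t s)) (q := (1 / 2 * p) ^ M) (by positivity)
    (pow_le_one₀ (by positivity) (by linarith))
    (e := fun t => 1 - (1 - P.ε (t + 1)) ^ M) ?_ ?_ (T + T₁ + 2) ?_ ?_
  · refine squeeze_zero (fun _ => measureReal_nonneg) (fun t => measureReal_mono ?_) hlim
    refine Set.inter_subset_inter_right _ fun ω hω h0 => hω ?_
    have h1 : P.L * rank (selection P (fun τ => D τ ω) t) = 0 :=
      Nat.eq_zero_of_add_eq_zero_right h0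
    exact (hrank _).1 ((Nat.mul_eq_zero.1 h1).resolve_left (by omega))
  · have := ((hε.const_sub 1).pow M).const_sub 1
    simpa using this
  · intro t
    have h1 := hP.ε_nonneg (t + 1)
    have h2 := hP.ε_le_one (show 1 ≤ t + 1 by omega)
    have := pow_le_one₀ (n := M) (show 0 ≤ 1 - P.ε (t + 1) by linarith) (by linarith)
    linarith
  · rintro t ht ⟨b, k⟩ hne
    have hεt : P.ε (t + 1) < 1 / 2 := hT₁ t (by omega)
    have main : ∃ b' : Profile M N,
        (∀ ω ∈ A t ∩ {ω | X t ω = (b, k)}, ∀ m, p ≤ exploitProb G P (fun τ => D τ ω)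
          (fun τ => g τ ω) (t + 1) m (b' m, false)) ∧
        ∀ ω ∈ A t ∩ {ω | X t ω = (b, k)}, selection P (fun τ => D τ ω) (t + 1) = b' →
          h (X (t + 1) ω) < h (b, k) := by
      -- While the memory is not yet constant, inertia of all CUs repeats the profile and raises the
      -- steadiness by one.
      by_cases hk : (k : ℕ) < P.L
      · refine ⟨b, fun ω hω m => hpξ.trans ?_, fun ω hω hsel => ?_⟩
        · have hb : selection P (fun τ => D τ ω) t = b := congrArg Prod.fst hω.2
          have := ξ_le_exploitProb (G := G) (fun τ => D τ ω) (fun τ => g τ ω) hP (t + 1) m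
          rwa [Nat.add_sub_cancel, hb] at this
        · have hb : selection P (fun τ => D τ ω) t = b := congrArg Prod.fst hω.2
          have hk' : steadiness P (fun τ => D τ ω) t = k :=
            congrArg (fun s : Profile M N × Fin (P.L + 1) => (s.2 : ℕ)) hω.2
          have hst : steadiness P (fun τ => D τ ω) (t + 1) = min P.L (k + 1) := by
            rw [steadiness, if_pos (hsel.trans hb.symm), hk']
          simp only [h, X, hsel, hst]
          omega
      · have hkL : (k : ℕ) = P.L := by have := k.2; omega
        have hr : rank b ≠ 0 := by
          intro h0
          apply hne
          simp [h, h0, hkL]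
        -- With a constant memory one CU makes the better reply that leads towards an equilibrium,
        -- and inertia holds the others.
        obtain ⟨b', hstep, hlt⟩ := (hrank b).2 hr
        refine ⟨b', fun ω hω m => ?_, fun ω hω hsel => ?_⟩
        · have hb : selection P (fun τ => D τ ω) t = b := congrArg Prod.fst hω.2
          have hk' : steadiness P (fun τ => D τ ω) t = k :=
            congrArg (fun s : Profile M N × Fin (P.L + 1) => (s.2 : ℕ)) hω.2
          obtain ⟨i, x, hx, hmem⟩ := mem_betterReplies_of_step hG hties hP (by omega)
            (hω.1 t (by omega) le_rfl) (hk'.trans hkL) (by rw [hb]; exact hstep)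
          rw [hx]
          rcases eq_or_ne m i with rfl | hmi
          · rw [Function.update_self]
            refine hpc.trans (le_trans ?_
              (le_exploitProb_of_mem_betterReplies _ _ hP hmem))
            exact mul_le_mul_of_nonneg_left (hreply _ _ _ hmem) (by linarith)
          · rw [Function.update_of_ne hmi]
            exact hpξ.trans (ξ_le_exploitProb (G := G) (fun τ => D τ ω) (fun τ => g τ ω)
              hP (t + 1) m)
        · have hb : selection P (fun τ => D τ ω) t = b := congrArg Prod.fst hω.2
          have hst : steadiness P (fun τ => D τ ω) (t + 1) = 1 := by
            rw [steadiness, if_neg]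
            rw [hsel, hb]
            rintro rfl
            exact lt_irrefl _ hlt
          simp only [h, X, hsel, hst, hkL]
          have : P.L * (rank b' + 1) ≤ P.L * rank b := Nat.mul_le_mul_left _ hlt
          rw [mul_add] at this
          omega
    obtain ⟨b', hb1, hb2⟩ := main
    refine (hrun.mul_measureReal_le (t := t) (by omega) ((hAm t).inter (hXm t (b, k)))
      (fun m => (b' m, false)) fun ω hω => ?_).trans (measureReal_mono ?_)
    · refine le_trans ?_ (pow_le_prod_decisionProb _ _ hP (by omega) hp.le (hb1 ω hω))
      exact pow_le_pow_left₀ (by positivity)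
        (mul_le_mul_of_nonneg_right (by linarith) hp.le) _
    · rintro ω ⟨hω, hD⟩
      exact ⟨hω, hb2 ω hω (hselnext t ω b' (by omega) hD)⟩
  -- Rank `0` means an equilibrium filling the whole memory. No CU has a better reply, so the
  -- profile is repeated unless somebody explores.
  · rintro t ht ⟨b, k⟩ h0
    have hkL : (k : ℕ) = P.L := by
      have h1 := k.2
      have h2 : P.L - (k : ℕ) = 0 := Nat.eq_zero_of_add_eq_zero_left h0
      omega
    have hr : rank b = 0 := by
      have h1 : P.L * rank b = 0 := Nat.eq_zero_of_add_eq_zero_right h0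
      exact (Nat.mul_eq_zero.1 h1).resolve_left (by omega)
    have heq := (hrank b).1 hr
    obtain ⟨E, hE⟩ : ∃ E, E = A t ∩ {ω | X t ω = (b, k)} := ⟨_, rfl⟩
    have hEm : MeasurableSet[ℱ t] E := hE ▸ (hAm t).inter (hXm t (b, k))
    have hω : ∀ ω ∈ E, selection P (fun τ => D τ ω) t = b ∧
        steadiness P (fun τ => D τ ω) t = P.L := by
      intro ω hω
      rw [hE] at hω
      exact ⟨congrArg Prod.fst hω.2, (congrArg
        (fun s : Profile M N × Fin (P.L + 1) => (s.2 : ℕ)) hω.2).trans hkL⟩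
    have hge : (1 - P.ε (t + 1)) ^ M * μ.real E ≤
        μ.real (E ∩ {ω | D (t + 1) ω = fun m => (b m, false)}) := by
      refine hrun.mul_measureReal_le (by omega) hEm (fun m => (b m, false)) fun ω hωE => ?_
      obtain ⟨hb, hk'⟩ := hω ω hωE
      have := pow_le_prod_decisionProb (G := G) (fun τ => D τ ω) (fun τ => g τ ω) hP
        (t := t + 1) (by omega) (y := fun m => (b m, false)) zero_le_one fun m => ?_
      · rwa [mul_one] at this
      · have hemp := betterReplies_eq_empty hG hties hP (by omega)
          ((hE ▸ hωE : ω ∈ A t ∩ {ω | X t ω = (b, k)}).1 t (by omega) le_rfl) hk'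
          (by rw [hb]; exact heq) m
        have h1 := exploitProb_of_betterReplies_empty (fun τ => D τ ω) (fun τ => g τ ω) hemp
        rw [Nat.add_sub_cancel, hb] at h1
        exact h1.ge
    rw [← hE]
    have hDm : MeasurableSet {ω | D (t + 1) ω = fun m => (b m, false)} :=
      ℱ.le _ _ (hrun.measurableSet_decision (by omega) _)
    have hsplit := measureReal_inter_add_sdiff (μ := μ) (s := E) hDm
    have hsub : μ.real (E ∩ {ω | h (X (t + 1) ω) ≠ 0}) ≤
        μ.real (E \ {ω | D (t + 1) ω = fun m => (b m, false)}) := by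
      refine measureReal_mono ?_
      rintro ω ⟨hωE, hne⟩
      refine ⟨hωE, fun hD => hne ?_⟩
      obtain ⟨hb, hk'⟩ := hω ω hωE
      have hsel := hselnext t ω b (by omega) hD
      have hst : steadiness P (fun τ => D τ ω) (t + 1) = P.L := by
        rw [steadiness, if_pos (hsel.trans hb.symm), hk']
        omega
      simp only [h, X, hsel, hst, hr]
      simp
    linarith

theorem tendsto_isStable (hrun : IsRun G P μ ℱ D g) (hG : G.Standing)
    (hties : G.NoTies) (hP : P.Valid) (hM : 0 < M) (hN : 0 < N) :
    Tendsto (fun t => μ {ω | G.IsStable (G.matching (selection P (fun τ => D τ ω) t))})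
      atTop (𝓝 1) := by
  have hreal : Tendsto
      (fun t => μ.real {ω | G.IsStable (G.matching (selection P (fun τ => D τ ω) t))})
      atTop (𝓝 1) := by
    refine tendsto_order.2 ⟨fun a ha => ?_,
      fun a ha => Eventually.of_forall fun t => measureReal_le_one.trans_lt ha⟩
    -- `T` is fixed first, making accuracy from `T` on more likely than `a'`; then `t` is taken
    -- large, making disequilibrium under accuracy less likely than `a' - a`.
    obtain ⟨a', ha', ha1⟩ := exists_between ha
    obtain ⟨T, hT⟩ := ((hrun.tendsto_accurate_from hG hties hP hM hN).eventually_const_lt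
      ha1).exists
    filter_upwards [(hrun.tendsto_unsettled hG hties hP hM T).eventually_lt_const
      (sub_pos.2 ha')] with t ht
    have hsub : {ω | ∀ t ≥ T, Accurate G (stateAt G P (fun τ => D τ ω) (fun τ => g τ ω) t)} ⊆
        {ω | G.IsStable (G.matching (selection P (fun τ => D τ ω) t))} ∪
        ({ω | ∀ τ, T ≤ τ → τ ≤ t →
            Accurate G (stateAt G P (fun τ => D τ ω) (fun τ => g τ ω) τ)} ∩
          {ω | ¬ Market.IsEquilibrium G.UCstar G.merit (selection P (fun τ => D τ ω) t)}) := by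
      intro ω hω
      by_cases he : Market.IsEquilibrium G.UCstar G.merit (selection P (fun τ => D τ ω) t)
      · exact Or.inl (Network.isStable_of_isEquilibrium hG he)
      · exact Or.inr ⟨fun τ hτ _ => hω τ hτ, he⟩
    have := (measureReal_mono (μ := μ) hsub).trans (measureReal_union_le _ _)
    linarith
  have := (ENNReal.continuous_ofReal.tendsto 1).comp hreal
  rw [ENNReal.ofReal_one] at this
  exact this.congr fun t => ENNReal.ofReal_toReal (measure_ne_top _ _)

end IsRun

end EBRIQ

end

theorem theorem3 {M N : ℕ} (hN : 0 < N)
    (G : EBRIQ.Network M N) (hG : G.Standing) (hties : G.NoTies)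
    (P : EBRIQ.Params M N) (hP : P.Valid)
    {Ω : Type*} {mΩ : MeasurableSpace Ω} (μ : Measure Ω) [IsProbabilityMeasure μ]
    (ℱ : Filtration ℕ mΩ)
    (D : ℕ → Ω → Fin M → EBRIQ.Decision N) (g : ℕ → Ω → EBRIQ.Gains M N)
    (hrun : EBRIQ.IsRun G P μ ℱ D g) :
    (∀ᵐ ω ∂μ, ∀ (m : Fin M) (n : Fin N),
      Tendsto (fun t => EBRIQ.alphaAt G P (fun τ => D τ ω) (fun τ => g τ ω) t m n) atTop
        (𝓝 (G.alphaStar m n))) ∧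
    Tendsto
      (fun t => μ {ω | G.IsStable (G.matching (EBRIQ.selection P (fun τ => D τ ω) t))}) atTop
      (𝓝 1) := by
  refine ⟨ae_all_iff.2 fun m => ae_all_iff.2 fun n => ?_, ?_⟩
  · filter_upwards [hrun.ae_tendsto_Rhat hG hP hN m n] with ω hω
    exact EBRIQ.tendsto_alphaAt hG hω
  · rcases Nat.eq_zero_or_pos M with rfl | hM
    -- Without CUs the exploration rate need not vanish, since its exponent is a division by zero,
    -- but every matching is trivially stable.
    · have : ∀ b, G.IsStable (G.matching b) :=
        fun b => ⟨fun m => m.elim0, fun ⟨m, _⟩ => m.elim0⟩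
      simp [this]
    · exact hrun.tendsto_isStable hG hties hP hM hN
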